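/- A directed graph $E=(E^0,E^1,r,s)$ consists of sets $E^0$ (vertices) and $E^1$ (edges) and maps $r,s:E^1\to E^0$; sets carry the discrete topology. Its graph correspondence $X(E)$ is the C*-correspondence over $c_0(E^0)$ obtained by completing the space $c_c(E^1)$ of finitely supported functions on $E^1$ with respect to the inner product $\langle x,y\rangle(v)=\sum_{s(e)=v}\overline{x(e)}\,y(e)$, with right action $(x\cdot a)(e)=x(e)\,a(s(e))$ and left action $(\phi(a)x)(e)=a(r(e))\,x(e)$. For a C*-correspondence $X$ over a C*-algebra $A$ with left action $\phi_X$, let $\mathcal K(X)$ be the closed linear span of the operators $z\mapsto x\cdot\langle y,z\rangle$ ($x,y\in X$), and let the Katsura ideal be $$J_X=\{a\in A:\ \phi_X(a)\in\mathcal K(X)\ \text{and}\ ab=0\ \text{for all } b\in\ker\phi_X\}.$$ For correspondences $X$ over $A$ and $Y$ over $B$, let $X\otimes Y$ be the external tensor product, a correspondence over $A\otimes B$: the completion of the algebraic tensor product with $\langle x\otimes y,x'\otimes y'\rangle=\langle x,x'\rangle\otimes\langle y,y'\rangle$, $(x\otimes y)\cdot(a\otimes b)=x\cdot a\otimes y\cdot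 b$ and $\phi(a\otimes b)(x\otimes y)=\phi_X(a)x\otimes\phi_Y(b)y$. (Below, $A$ and $B$ are commutative, so there is only one C*-tensor product $A\otimes B$.) For closed ideals $I\subseteq A$ and $J\subseteq B$, let $I\otimes J\subseteq A\otimes B$ be the closed linear span of $\{a\otimes b: a\in I,\ b\in J\}$. Proposition. Let $E$ and $F$ be directed graphs and let $X=X(E)$ and $Y=X(F)$ be their graph correspondences, over $c_0(E^0)$ and $c_0(F^0)$. Then $X$ and $Y$ are ideal-compatible, that is, $$J_{X\otimes Y}=J_X\otimes J_Y$$ as ideals of $c_0(E^0)\otimes c_0(F^0)$. -/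

import Mathlib

open scoped TensorProduct ZeroAtInfty ComplexConjugate

noncomputable section

namespace CStarCorr

universe u v w

/-! ### Completion of a vector space with respect to a seminorm -/

section Completion

variable {M : Type u} [AddCommGroup M] [Module ℂ M]

/-- A copy of `M`, carrying the topology of the seminorm `p`. -/
def Seminormed (_p : Seminorm ℂ M) : Type u := M

instance (p : Seminorm ℂ M) : SeminormedAddCommGroup (Seminormed p) :=
  p.toAddGroupSeminorm.toSeminormedAddCommGroup

instance (p : Seminorm ℂ M) : Module ℂ (Seminormed p) := inferInstanceAs (Module ℂ M)

instance (p : Seminorm ℂ M) : NormedSpace ℂ (Seminormed p) where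
  norm_smul_le c x := (map_smul_eq_mul p c x).le

/-- The Hausdorff completion of `M` with respect to the seminorm `p`: vectors of seminorm zero are
divided out, and the quotient is completed. -/
def SeminormCompletion (p : Seminorm ℂ M) : Type u := UniformSpace.Completion (Seminormed p)

instance (p : Seminorm ℂ M) : NormedAddCommGroup (SeminormCompletion p) :=
  inferInstanceAs (NormedAddCommGroup (UniformSpace.Completion (Seminormed p)))

instance (p : Seminorm ℂ M) : NormedSpace ℂ (SeminormCompletion p) :=
  inferInstanceAs (NormedSpace ℂ (UniformSpace.Completion (Seminormed p)))

instance (p : Seminorm ℂ M) : CompleteSpace (SeminormCompletion p) :=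
  inferInstanceAs (CompleteSpace (UniformSpace.Completion (Seminormed p)))

/-- The canonical map of `M` into its completion. -/
def toCompletion (p : Seminorm ℂ M) : M →ₗ[ℂ] SeminormCompletion p where
  toFun x := UniformSpace.Completion.coe' (α := Seminormed p) x
  map_add' x y := UniformSpace.Completion.coe_add (α := Seminormed p) x y
  map_smul' c x := UniformSpace.Completion.coe_smul (X := Seminormed p) c x

theorem norm_toCompletion (p : Seminorm ℂ M) (x : M) : ‖toCompletion p x‖ = p x :=
  UniformSpace.Completion.norm_coe (E := Seminormed p) x

theorem denseRange_toCompletion (p : Seminorm ℂ M) : DenseRange (toCompletion p) :=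
  UniformSpace.Completion.denseRange_coe (α := Seminormed p)

end Completion

/-! ### Continuous extension of bilinear and sesquilinear maps -/

section Extension

variable {M N Z W G : Type*} [AddCommGroup M] [Module ℂ M] [AddCommGroup N] [Module ℂ N]
  [NormedAddCommGroup Z] [NormedSpace ℂ Z] [NormedAddCommGroup W] [NormedSpace ℂ W]
  [NormedAddCommGroup G] [NormedSpace ℂ G] [CompleteSpace G]
  {σ : ℂ →+* ℂ}

/-- The continuous extension of a bounded bilinear (or sesquilinear) map from `M × N` to `Z × W`,
along linear maps with dense range. -/
def extendBilin (e : M →ₗ[ℂ] Z) (f : N →ₗ[ℂ] W) (T : M →ₛₗ[σ] N →ₗ[ℂ] G)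
    (hf : DenseRange f) (C : ℝ) (hT : ∀ x y, ‖T x y‖ ≤ C * ‖e x‖ * ‖f y‖) :
    Z →SL[σ] W →L[ℂ] G :=
  LinearMap.extendOfNorm (F := W →L[ℂ] G)
    { toFun := fun x => (T x).extendOfNorm f
      map_add' := fun x y => by
        refine ContinuousLinearMap.coeFn_injective (hf.equalizer
          (ContinuousLinearMap.continuous _) (ContinuousLinearMap.continuous _) ?_)
        ext z
        simp only [Function.comp_apply]
        rw [LinearMap.extendOfNorm_eq hf ⟨_, hT _⟩, _root_.add_apply,
          LinearMap.extendOfNorm_eq hf ⟨_, hT _⟩, LinearMap.extendOfNorm_eq hf ⟨_, hT _⟩]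
        simp
      map_smul' := fun c x => by
        refine ContinuousLinearMap.coeFn_injective (hf.equalizer
          (ContinuousLinearMap.continuous _) (ContinuousLinearMap.continuous _) ?_)
        ext z
        simp only [Function.comp_apply]
        rw [LinearMap.extendOfNorm_eq hf ⟨_, hT _⟩, _root_.smul_apply,
          LinearMap.extendOfNorm_eq hf ⟨_, hT _⟩]
        simp } e

theorem extendBilin_apply (e : M →ₗ[ℂ] Z) (f : N →ₗ[ℂ] W) (T : M →ₛₗ[σ] N →ₗ[ℂ] G)
    (he : DenseRange e) (hf : DenseRange f) (C : ℝ) (hC : 0 ≤ C)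
    (hT : ∀ x y, ‖T x y‖ ≤ C * ‖e x‖ * ‖f y‖) (x : M) (y : N) :
    extendBilin e f T hf C hT (e x) (f y) = T x y := by
  rw [extendBilin, LinearMap.extendOfNorm_eq he
    ⟨C, fun x => LinearMap.opNorm_extendOfNorm_le hf (by positivity) (hT x)⟩]
  exact LinearMap.extendOfNorm_eq hf ⟨_, hT x⟩ y

end Extension

/-! ### The tensor product of two C⋆-algebras -/

section CStarTensor

variable {A : Type u} {B : Type v} [NonUnitalCStarAlgebra A] [NonUnitalCStarAlgebra B]

/-- A seminorm on the algebraic tensor product of two C⋆-algebras is a C⋆-seminorm if it is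
submultiplicative, satisfies the C⋆-identity and is at most `‖a‖ * ‖b‖` on `a ⊗ b`. (The last bound
is automatic: it holds for every ⋆-representation of the algebraic tensor product.) -/
structure IsCStarSeminorm (p : Seminorm ℂ (A ⊗[ℂ] B)) : Prop where
  mul_le : ∀ s t, p (s * t) ≤ p s * p t
  star_mul_self : ∀ t, p (star t * t) = p t ^ 2
  tmul_le : ∀ a b, p (a ⊗ₜ[ℂ] b) ≤ ‖a‖ * ‖b‖

theorem IsCStarSeminorm.star_le {p : Seminorm ℂ (A ⊗[ℂ] B)} (hp : IsCStarSeminorm p)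
    (t : A ⊗[ℂ] B) : p t ≤ p (star t) := by
  rcases (apply_nonneg p t).eq_or_lt with h | h
  · rw [← h]; exact apply_nonneg p _
  · have := hp.mul_le (star t) t
    rw [hp.star_mul_self, sq] at this
    exact le_of_mul_le_mul_right this h

theorem IsCStarSeminorm.star_eq {p : Seminorm ℂ (A ⊗[ℂ] B)} (hp : IsCStarSeminorm p)
    (t : A ⊗[ℂ] B) : p (star t) = p t :=
  le_antisymm (by simpa using hp.star_le (star t)) (hp.star_le t)

variable (A B) in
/-- The C⋆-norm on the algebraic tensor product: the supremum of all C⋆-seminorms. (This is the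
largest C⋆-norm. If `A` or `B` is nuclear, for instance commutative, it is the only one.) -/
def tensorSeminorm : Seminorm ℂ (A ⊗[ℂ] B) := sSup {p | IsCStarSeminorm p}

theorem exists_bound (t : A ⊗[ℂ] B) :
    ∃ C, ∀ p : Seminorm ℂ (A ⊗[ℂ] B), IsCStarSeminorm p → p t ≤ C := by
  induction t using TensorProduct.induction_on with
  | zero => exact ⟨0, fun p _ => by simp⟩
  | tmul a b => exact ⟨_, fun p hp => hp.tmul_le a b⟩
  | add s t hs ht =>
    obtain ⟨C, hC⟩ := hs
    obtain ⟨D, hD⟩ := ht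
    exact ⟨C + D, fun p hp => (map_add_le_add p s t).trans (add_le_add (hC p hp) (hD p hp))⟩

theorem bddAbove_cstarSeminorms :
    BddAbove {p : Seminorm ℂ (A ⊗[ℂ] B) | IsCStarSeminorm p} := by
  rw [Seminorm.bddAbove_iff]
  choose C hC using exists_bound (A := A) (B := B)
  refine ⟨C, ?_⟩
  rintro _ ⟨p, hp, rfl⟩ t
  exact hC t p hp

theorem IsCStarSeminorm.le_tensorSeminorm {p : Seminorm ℂ (A ⊗[ℂ] B)} (hp : IsCStarSeminorm p)
    (t : A ⊗[ℂ] B) : p t ≤ tensorSeminorm A B t := by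
  have : p ≤ tensorSeminorm A B := le_csSup bddAbove_cstarSeminorms hp
  exact this t

theorem isCStarSeminorm_zero : IsCStarSeminorm (0 : Seminorm ℂ (A ⊗[ℂ] B)) :=
  ⟨by simp, by simp, fun a b => by simp; positivity⟩

theorem tensorSeminorm_le {t : A ⊗[ℂ] B} {C : ℝ}
    (h : ∀ p : Seminorm ℂ (A ⊗[ℂ] B), IsCStarSeminorm p → p t ≤ C) :
    tensorSeminorm A B t ≤ C := by
  rw [tensorSeminorm, Seminorm.sSup_apply bddAbove_cstarSeminorms]
  have : Nonempty {p : Seminorm ℂ (A ⊗[ℂ] B) | IsCStarSeminorm p} :=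
    ⟨⟨0, isCStarSeminorm_zero⟩⟩
  exact ciSup_le fun p => h p.1 p.2

theorem isCStarSeminorm_tensorSeminorm : IsCStarSeminorm (tensorSeminorm A B) where
  mul_le s t := tensorSeminorm_le fun p hp => (hp.mul_le s t).trans
    (mul_le_mul (hp.le_tensorSeminorm s) (hp.le_tensorSeminorm t) (apply_nonneg p _)
      (apply_nonneg _ _))
  star_mul_self t := by
    refine le_antisymm (tensorSeminorm_le fun p hp => ?_) ?_
    · rw [hp.star_mul_self]
      exact pow_le_pow_left₀ (apply_nonneg p t) (hp.le_tensorSeminorm t) 2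
    · rw [← Real.le_sqrt (apply_nonneg _ _) (apply_nonneg _ _)]
      refine tensorSeminorm_le fun p hp => ?_
      rw [Real.le_sqrt (apply_nonneg _ _) (apply_nonneg _ _), ← hp.star_mul_self]
      exact hp.le_tensorSeminorm _
  tmul_le a b := tensorSeminorm_le fun p hp => hp.tmul_le a b

variable (A B) in
/-- The C⋆-algebraic tensor product `A ⊗ B`: the completion of the algebraic tensor product in its
C⋆-norm. -/
def CStarTensor : Type (max u v) := SeminormCompletion (tensorSeminorm A B)

instance : NormedAddCommGroup (CStarTensor A B) :=
  inferInstanceAs (NormedAddCommGroup (SeminormCompletion (tensorSeminorm A B)))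

instance : NormedSpace ℂ (CStarTensor A B) :=
  inferInstanceAs (NormedSpace ℂ (SeminormCompletion (tensorSeminorm A B)))

instance : CompleteSpace (CStarTensor A B) :=
  inferInstanceAs (CompleteSpace (SeminormCompletion (tensorSeminorm A B)))

namespace CStarTensor

variable (A B) in
/-- The canonical map of the algebraic tensor product into the C⋆-algebraic one. -/
def ofAlg : A ⊗[ℂ] B →ₗ[ℂ] CStarTensor A B := toCompletion (tensorSeminorm A B)

theorem norm_ofAlg (t : A ⊗[ℂ] B) : ‖ofAlg A B t‖ = tensorSeminorm A B t :=
  norm_toCompletion _ t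

theorem denseRange_ofAlg : DenseRange (ofAlg A B) := denseRange_toCompletion _

variable (A B) in
/-- The multiplication of `A ⊗ B`, extended from the algebraic tensor product. -/
def mulL : CStarTensor A B →L[ℂ] CStarTensor A B →L[ℂ] CStarTensor A B :=
  extendBilin (ofAlg A B) (ofAlg A B) ((LinearMap.mul ℂ (A ⊗[ℂ] B)).compr₂ (ofAlg A B))
    denseRange_ofAlg 1 fun s t => by
      simpa [norm_ofAlg] using isCStarSeminorm_tensorSeminorm.mul_le s t

theorem mulL_ofAlg (s t : A ⊗[ℂ] B) :
    mulL A B (ofAlg A B s) (ofAlg A B t) = ofAlg A B (s * t) :=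
  extendBilin_apply _ _ _ denseRange_ofAlg _ _ zero_le_one _ s t

variable (A B) in
/-- The involution of `A ⊗ B`, extended from the algebraic tensor product. -/
def starL : CStarTensor A B →L⋆[ℂ] CStarTensor A B :=
  LinearMap.extendOfNorm
    ((ofAlg A B).comp (starLinearEquiv ℂ (A := A ⊗[ℂ] B)).toLinearMap) (ofAlg A B)

theorem starL_ofAlg (t : A ⊗[ℂ] B) : starL A B (ofAlg A B t) = ofAlg A B (star t) :=
  LinearMap.extendOfNorm_eq denseRange_ofAlg ⟨1, fun t => by
    simp [norm_ofAlg, isCStarSeminorm_tensorSeminorm.star_eq t]⟩ t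

theorem induction {P : CStarTensor A B → Prop} (hP : IsClosed {x | P x})
    (h : ∀ t, P (ofAlg A B t)) (x : CStarTensor A B) : P x :=
  denseRange_ofAlg.induction_on x hP h

instance : Mul (CStarTensor A B) := ⟨fun x y => mulL A B x y⟩
instance : Star (CStarTensor A B) := ⟨fun x => starL A B x⟩

theorem mul_def (x y : CStarTensor A B) : x * y = mulL A B x y := rfl
theorem star_def (x : CStarTensor A B) : star x = starL A B x := rfl

theorem ofAlg_mul (s t : A ⊗[ℂ] B) : ofAlg A B (s * t) = ofAlg A B s * ofAlg A B t :=
  (mulL_ofAlg s t).symm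

theorem ofAlg_star (t : A ⊗[ℂ] B) : ofAlg A B (star t) = star (ofAlg A B t) :=
  (starL_ofAlg t).symm

theorem continuous_mul' : Continuous fun x : CStarTensor A B × CStarTensor A B => x.1 * x.2 :=
  (mulL A B).continuous₂

theorem continuous_star' : Continuous fun x : CStarTensor A B => star x := (starL A B).continuous

instance : NonUnitalNormedRing (CStarTensor A B) where
  left_distrib x y z := by simp [mul_def]
  right_distrib x y z := by simp [mul_def]
  zero_mul x := by simp [mul_def]
  mul_zero x := by simp [mul_def]
  mul_assoc x y z := by
    refine denseRange_ofAlg.induction_on₃ (p := fun x y z => x * y * z = x * (y * z)) ?_ ?_ x y z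
    · refine isClosed_eq ?_ ?_
      · exact continuous_mul'.comp ((continuous_mul'.comp
          (continuous_fst.prodMk continuous_snd.fst)).prodMk continuous_snd.snd)
      · exact continuous_mul'.comp (continuous_fst.prodMk (continuous_mul'.comp continuous_snd))
    · intro r s t
      simp only [← ofAlg_mul, mul_assoc]
  dist_eq x y := dist_eq_norm_neg_add x y
  norm_mul_le x y := by
    refine denseRange_ofAlg.induction_on₂ (p := fun x y => ‖x * y‖ ≤ ‖x‖ * ‖y‖) ?_ ?_ x y
    · exact isClosed_le continuous_mul'.norm (continuous_fst.norm.mul continuous_snd.norm)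
    · intro s t
      simpa only [← ofAlg_mul, norm_ofAlg] using isCStarSeminorm_tensorSeminorm.mul_le s t

instance : StarRing (CStarTensor A B) where
  star_involutive x := by
    refine induction (P := fun x => star (star x) = x)
      (isClosed_eq (continuous_star'.comp continuous_star') continuous_id) (fun t => ?_) x
    simp only [← ofAlg_star, star_star]
  star_mul x y := by
    refine denseRange_ofAlg.induction_on₂ (p := fun x y => star (x * y) = star y * star x) ?_ ?_ x y
    · exact isClosed_eq (continuous_star'.comp continuous_mul')
        (continuous_mul'.comp ((continuous_star'.comp continuous_snd).prodMk
          (continuous_star'.comp continuous_fst)))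
    · intro s t
      simp only [← ofAlg_star, ← ofAlg_mul, star_mul]
  star_add x y := by simp [star_def]

/-- `A ⊗ B` is a C⋆-algebra. -/
instance : NonUnitalCStarAlgebra (CStarTensor A B) where
  norm_mul_self_le x := by
    refine induction (P := fun x => ‖x‖ * ‖x‖ ≤ ‖star x * x‖) ?_ (fun t => ?_) x
    · exact isClosed_le (continuous_norm.mul continuous_norm)
        (continuous_mul'.comp (continuous_star'.prodMk continuous_id)).norm
    · simp only [← ofAlg_star, ← ofAlg_mul, norm_ofAlg,
        isCStarSeminorm_tensorSeminorm.star_mul_self, sq, le_refl]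
  smul_assoc c x y := by simp [mul_def]
  smul_comm c x y := by simp [mul_def]
  star_smul c x := by simp [star_def]

variable (A B) in
/-- The canonical map of the algebraic tensor product into the C⋆-algebraic one, as a
⋆-homomorphism. -/
def incl : A ⊗[ℂ] B →⋆ₙₐ[ℂ] CStarTensor A B where
  toFun := ofAlg A B
  map_smul' c t := map_smul _ c t
  map_zero' := map_zero _
  map_add' := map_add _
  map_mul' := ofAlg_mul
  map_star' := ofAlg_star

theorem norm_incl (t : A ⊗[ℂ] B) : ‖incl A B t‖ = tensorSeminorm A B t := norm_ofAlg t

theorem denseRange_incl : DenseRange (incl A B) := denseRange_ofAlg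

end CStarTensor

end CStarTensor

/-! ### C⋆-correspondences, compact operators and the Katsura ideal -/

/-- A C⋆-correspondence over a C⋆-algebra `A`: a right Hilbert `A`-module, complete in the norm
`‖x‖ = ‖⟨x, x⟩‖ ^ (1 / 2)`, together with a homomorphism of `A` into the adjointable operators, such
that the adjoint of the operator given by `a` is the operator given by `star a`. (Adjointable
operators are bounded and linear for the right action; a positive element of a C⋆-algebra is one of
the form `star a * a`.) -/
structure Correspondence (A : Type u) [NonUnitalCStarAlgebra A] where
  /-- The underlying Banach space. -/
  carrier : Type v
  [normedAddCommGroup : NormedAddCommGroup carrier]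
  [normedSpace : NormedSpace ℂ carrier]
  [completeSpace : CompleteSpace carrier]
  /-- The inner product, conjugate linear in the first variable. -/
  inner : carrier →ₗ⋆[ℂ] carrier →ₗ[ℂ] A
  /-- The right action: `act x a = x · a`. -/
  act : carrier →ₗ[ℂ] A →ₗ[ℂ] carrier
  /-- The left action: `left a x = a · x`. -/
  left : A →ₙₐ[ℂ] (carrier →L[ℂ] carrier)
  star_inner : ∀ x y, star (inner x y) = inner y x
  inner_self_nonneg : ∀ x, ∃ a, inner x x = star a * a
  norm_sq : ∀ x, ‖x‖ ^ 2 = ‖inner x x‖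
  act_act : ∀ x a b, act (act x a) b = act x (a * b)
  inner_act : ∀ x y a, inner x (act y a) = inner x y * a
  inner_left : ∀ a x y, inner (left a x) y = inner x (left (star a) y)

attribute [instance] Correspondence.normedAddCommGroup Correspondence.normedSpace
  Correspondence.completeSpace

namespace Correspondence

variable {A : Type u} [NonUnitalCStarAlgebra A] (X : Correspondence.{u, v} A)

/-- The compact operators `K(X)`: the closed linear span of the rank-one operators
`z ↦ x · ⟨y, z⟩`. -/
def compacts : Submodule ℂ (X.carrier →L[ℂ] X.carrier) :=
  (Submodule.span ℂ {T | ∃ x y, ∀ z, T z = X.act x (X.inner y z)}).topologicalClosure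

/-- The Katsura ideal: the elements `a` of `A` that act by a compact operator and satisfy `a b = 0`
for all `b` in the kernel of the left action. -/
def katsuraIdeal : Submodule ℂ A where
  carrier := {a | X.left a ∈ X.compacts ∧ ∀ b, X.left b = 0 → a * b = 0}
  add_mem' := by
    rintro a b ⟨ha, ha'⟩ ⟨hb, hb'⟩
    refine ⟨?_, fun c hc => ?_⟩
    · rw [map_add]; exact add_mem ha hb
    · rw [add_mul, ha' c hc, hb' c hc, add_zero]
  zero_mem' := ⟨by rw [map_zero]; exact zero_mem _, fun b _ => zero_mul b⟩
  smul_mem' := by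
    rintro z a ⟨ha, ha'⟩
    refine ⟨?_, fun c hc => ?_⟩
    · rw [map_smul]; exact Submodule.smul_mem _ z ha
    · rw [smul_mul_assoc, ha' c hc, smul_zero]

end Correspondence

/-! ### Completing a pre-Hilbert module to a correspondence -/

/-- A right module `M` over a ⋆-algebra `A₀` that maps onto a dense subalgebra of a C⋆-algebra `A`,
with an `A`-valued positive semidefinite inner product. -/
structure PreHilbertModule (A₀ : Type*) (A : Type*) (M : Type*) [NonUnitalRing A₀] [StarRing A₀]
    [Module ℂ A₀] [NonUnitalCStarAlgebra A] [AddCommGroup M] [Module ℂ M] where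
  /-- The map of `A₀` to `A`. -/
  incl : A₀ →⋆ₙₐ[ℂ] A
  denseRange_incl : DenseRange incl
  /-- The inner product, conjugate linear in the first variable. -/
  inner : M →ₗ⋆[ℂ] M →ₗ[ℂ] A
  /-- The right action. -/
  act : M →ₗ[ℂ] A₀ →ₗ[ℂ] M
  star_inner : ∀ x y, star (inner x y) = inner y x
  inner_self_nonneg : ∀ x, ∃ a, inner x x = star a * a
  inner_act : ∀ x y a, inner x (act y a) = inner x y * incl a

namespace PreHilbertModule

variable {A₀ : Type*} {A : Type u} {M : Type v} [NonUnitalRing A₀] [StarRing A₀]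
    [Module ℂ A₀] [NonUnitalCStarAlgebra A] [AddCommGroup M] [Module ℂ M]
    (P : PreHilbertModule A₀ A M)

theorem inner_act_left (x y : M) (a : A₀) :
    P.inner (P.act x a) y = star (P.incl a) * P.inner x y := by
  rw [← P.star_inner, P.inner_act, star_mul, P.star_inner]

theorem norm_inner_sq_le (x y : M) :
    ‖P.inner x y‖ ^ 2 ≤ ‖P.inner x x‖ * ‖P.inner y y‖ := by
  let _ := CStarAlgebra.spectralOrder A
  let _ := CStarAlgebra.spectralOrderedRing A
  have key : ∀ b : A, 0 ≤ star b * P.inner x x * b - star b * P.inner x y - P.inner y x * b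
      + P.inner y y := by
    intro b
    refine P.denseRange_incl.induction_on (p := fun b : A => 0 ≤ star b * P.inner x x * b
      - star b * P.inner x y - P.inner y x * b + P.inner y y) b
      (isClosed_le continuous_const (by fun_prop)) fun a => ?_
    have h : 0 ≤ P.inner (P.act x a - y) (P.act x a - y) :=
      CStarAlgebra.nonneg_iff_eq_star_mul_self.2 (P.inner_self_nonneg _)
    convert h using 1
    simp only [map_sub, LinearMap.sub_apply, P.inner_act, P.inner_act_left]
    abel
  set c := P.inner x y with hc
  have hc' : P.inner y x = star c := (P.star_inner x y).symm
  have hQ : ∀ Q : ℝ, ‖P.inner x x‖ < Q → ‖c‖ ^ 2 ≤ Q * ‖P.inner y y‖ := by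
    intro Q hQ
    have hQ0 : 0 < Q := (norm_nonneg _).trans_lt hQ
    have h1 := key ((Q⁻¹ : ℝ) • c)
    rw [hc'] at h1
    have hsa : IsSelfAdjoint (P.inner x x) := P.star_inner x x
    have h2 : star c * P.inner x x * c ≤ Q • (star c * c) :=
      (CStarAlgebra.star_left_conjugate_le_norm_smul hsa).trans
        (smul_le_smul_of_nonneg_right hQ.le (star_mul_self_nonneg c))
    have h3 : (Q⁻¹ * Q⁻¹) • (star c * P.inner x x * c) ≤ Q⁻¹ • (star c * c) := by
      refine (smul_le_smul_of_nonneg_left h2 (by positivity)).trans_eq ?_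
      rw [smul_smul]; congr 1; field_simp
    have h4 : 0 ≤ Q⁻¹ • (star c * c) - Q⁻¹ • (star c * c) - Q⁻¹ • (star c * c) + P.inner y y := by
      refine h1.trans ?_
      simp only [star_smul, star_trivial, smul_mul_assoc, mul_smul_comm, smul_smul]
      gcongr
    rw [sub_self, zero_sub, neg_add_eq_sub, sub_nonneg] at h4
    have h5 := CStarAlgebra.norm_le_norm_of_nonneg_of_le
      (smul_nonneg (inv_nonneg.2 hQ0.le) (star_mul_self_nonneg c)) h4
    rw [norm_smul, CStarRing.norm_star_mul_self, Real.norm_of_nonneg (inv_nonneg.2 hQ0.le),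
      inv_mul_le_iff₀ hQ0] at h5
    rwa [sq]
  refine le_of_tendsto_of_tendsto (f := fun _ => ‖c‖ ^ 2) (g := fun Q => Q * ‖P.inner y y‖)
    (b := nhdsWithin ‖P.inner x x‖ (Set.Ioi ‖P.inner x x‖)) tendsto_const_nhds
    ((Filter.tendsto_id.mul_const _).mono_left nhdsWithin_le_nhds) ?_
  filter_upwards [self_mem_nhdsWithin] with Q h using hQ Q h

theorem norm_inner_le (x y : M) :
    ‖P.inner x y‖ ≤ √‖P.inner x x‖ * √‖P.inner y y‖ := by
  rw [← Real.sqrt_mul (norm_nonneg _)]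
  exact Real.le_sqrt_of_sq_le (P.norm_inner_sq_le x y)

/-- The seminorm `‖x‖ = ‖⟨x, x⟩‖ ^ (1 / 2)`. -/
def seminorm : Seminorm ℂ M :=
  Seminorm.of (fun x => √‖P.inner x x‖)
    (fun x y => by
      have h : ‖P.inner (x + y) (x + y)‖ ≤ (√‖P.inner x x‖ + √‖P.inner y y‖) ^ 2 := by
        have h1 := P.norm_inner_le x y
        have h2 := P.norm_inner_le y x
        have h3 := Real.sq_sqrt (norm_nonneg (P.inner x x))
        have h4 := Real.sq_sqrt (norm_nonneg (P.inner y y))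
        calc ‖P.inner (x + y) (x + y)‖
            = ‖P.inner x x + P.inner x y + (P.inner y x + P.inner y y)‖ := by
              simp only [map_add, LinearMap.add_apply]; congr 1; abel
          _ ≤ ‖P.inner x x‖ + ‖P.inner x y‖ + (‖P.inner y x‖ + ‖P.inner y y‖) :=
              (norm_add_le _ _).trans (add_le_add (norm_add_le _ _) (norm_add_le _ _))
          _ ≤ _ := by nlinarith
      exact (Real.sqrt_le_sqrt h).trans_eq (Real.sqrt_sq (by positivity)))
    (fun c x => by
      have : ‖P.inner (c • x) (c • x)‖ = ‖c‖ ^ 2 * ‖P.inner x x‖ := by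
        simp [norm_smul, sq, mul_assoc]
      rw [this, Real.sqrt_mul (by positivity), Real.sqrt_sq (norm_nonneg c)])

theorem seminorm_apply (x : M) : P.seminorm x = √‖P.inner x x‖ := rfl

theorem seminorm_sq (x : M) : P.seminorm x ^ 2 = ‖P.inner x x‖ := Real.sq_sqrt (norm_nonneg _)

theorem seminorm_act_le (x : M) (a : A₀) : P.seminorm (P.act x a) ≤ P.seminorm x * ‖P.incl a‖ := by
  refine Real.sqrt_le_iff.2 ⟨by positivity, ?_⟩
  rw [P.inner_act, P.inner_act_left, mul_pow, P.seminorm_sq]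
  calc _ ≤ ‖star (P.incl a)‖ * ‖P.inner x x‖ * ‖P.incl a‖ :=
        (norm_mul_le _ _).trans (mul_le_mul_of_nonneg_right (norm_mul_le _ _) (norm_nonneg _))
    _ = _ := by rw [norm_star]; ring

/-- A C⋆-algebra that acts by adjointable maps acts by contractions. -/
theorem seminorm_left_le {C : Type*} [NonUnitalCStarAlgebra C] (φ : C →ₙₐ[ℂ] Module.End ℂ M)
    (hφ : ∀ c x y, P.inner (φ c x) y = P.inner x (φ (star c) y)) (c : C) (x : M) :
    P.seminorm (φ c x) ≤ ‖c‖ * P.seminorm x := by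
  let _ := CStarAlgebra.spectralOrder A
  let _ := CStarAlgebra.spectralOrderedRing A
  let _ := CStarAlgebra.spectralOrder (Unitization ℂ C)
  let _ := CStarAlgebra.spectralOrderedRing (Unitization ℂ C)
  let Φ : Unitization ℂ C →ₐ[ℂ] Module.End ℂ M := Unitization.lift φ
  have hΦ : ∀ u x y, P.inner (Φ u x) y = P.inner x (Φ (star u) y) := by
    intro u x y
    induction u using Unitization.ind with
    | inl_add_inr z c =>
      simp [Φ, hφ, Algebra.algebraMap_eq_smul_one]
  obtain ⟨d, hd⟩ : ∃ d, (algebraMap ℝ (Unitization ℂ C) (‖c‖ ^ 2)) -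
      star (c : Unitization ℂ C) * c = star d * d := by
    rw [← CStarAlgebra.nonneg_iff_eq_star_mul_self, sub_nonneg]
    simpa [Unitization.norm_inr] using
      CStarAlgebra.star_mul_le_algebraMap_norm_sq (a := (c : Unitization ℂ C))
  have h0 : 0 ≤ P.inner (Φ d x) (Φ d x) :=
    CStarAlgebra.nonneg_iff_eq_star_mul_self.2 (P.inner_self_nonneg _)
  have h1 : P.inner (Φ d x) (Φ d x) = (‖c‖ ^ 2) • P.inner x x - P.inner (φ c x) (φ c x) := by
    have h2 : Φ c = φ c := by simp [Φ]
    rw [hΦ, ← Module.End.mul_apply, ← map_mul, ← hd, map_sub, map_mul, LinearMap.sub_apply, map_sub,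
      Module.End.mul_apply, ← hΦ, h2]
    congr 1
    rw [IsScalarTower.algebraMap_apply ℝ ℂ (Unitization ℂ C), AlgHom.commutes]
    simp [Algebra.algebraMap_eq_smul_one]
    norm_cast
  rw [h1, sub_nonneg] at h0
  have h3 := CStarAlgebra.norm_le_norm_of_nonneg_of_le
    (CStarAlgebra.nonneg_iff_eq_star_mul_self.2 (P.inner_self_nonneg _)) h0
  refine Real.sqrt_le_iff.2 ⟨by positivity, h3.trans_eq ?_⟩
  rw [norm_smul, mul_pow, P.seminorm_sq]
  simp

/-- The Hilbert module obtained by completion. -/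
abbrev Completed : Type v := SeminormCompletion P.seminorm

/-- The canonical map of `M` into its completion. -/
abbrev toCompleted : M →ₗ[ℂ] P.Completed := toCompletion P.seminorm

theorem norm_toCompleted (x : M) : ‖P.toCompleted x‖ = P.seminorm x := norm_toCompletion _ x

theorem denseRange_toCompleted : DenseRange P.toCompleted := denseRange_toCompletion _

/-- The inner product of the completion. -/
def innerL : P.Completed →L⋆[ℂ] P.Completed →L[ℂ] A :=
  extendBilin P.toCompleted P.toCompleted P.inner P.denseRange_toCompleted 1 fun x y => by
    rw [one_mul, P.norm_toCompleted, P.norm_toCompleted]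
    exact P.norm_inner_le x y

theorem continuous_innerL : Continuous fun z : P.Completed × P.Completed => P.innerL z.1 z.2 :=
  (P.innerL.continuous.comp continuous_fst).clm_apply continuous_snd

theorem innerL_mk (x y : M) : P.innerL (P.toCompleted x) (P.toCompleted y) = P.inner x y :=
  extendBilin_apply _ _ _ P.denseRange_toCompleted _ _ zero_le_one _ x y

/-- The right action on the completion. -/
def actL : P.Completed →L[ℂ] A →L[ℂ] P.Completed :=
  extendBilin P.toCompleted (P.incl : A₀ →ₗ[ℂ] A) (P.act.compr₂ P.toCompleted) P.denseRange_incl 1 fun x a => by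
    rw [one_mul, P.norm_toCompleted]
    exact (P.norm_toCompleted _).trans_le (P.seminorm_act_le x a)

theorem actL_mk (x : M) (a : A₀) : P.actL (P.toCompleted x) (P.incl a) = P.toCompleted (P.act x a) :=
  extendBilin_apply P.toCompleted (P.incl : A₀ →ₗ[ℂ] A) _ P.denseRange_toCompleted _ _ zero_le_one _ x a

/-- The left action on the completion. -/
def leftL (φ : A₀ →ₙₐ[ℂ] Module.End ℂ M)
    (hφ : ∀ a x, P.seminorm (φ a x) ≤ ‖P.incl a‖ * P.seminorm x) :
    A →L[ℂ] P.Completed →L[ℂ] P.Completed :=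
  extendBilin (P.incl : A₀ →ₗ[ℂ] A) P.toCompleted ((φ : A₀ →ₗ[ℂ] Module.End ℂ M).compr₂ P.toCompleted)
    P.denseRange_toCompleted 1 fun a x => by
      rw [one_mul, P.norm_toCompleted]
      exact (P.norm_toCompleted _).trans_le (hφ a x)

theorem leftL_mk (φ : A₀ →ₙₐ[ℂ] Module.End ℂ M)
    (hφ : ∀ a x, P.seminorm (φ a x) ≤ ‖P.incl a‖ * P.seminorm x) (a : A₀) (x : M) :
    P.leftL φ hφ (P.incl a) (P.toCompleted x) = P.toCompleted (φ a x) :=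
  extendBilin_apply (P.incl : A₀ →ₗ[ℂ] A) P.toCompleted _ P.denseRange_incl P.denseRange_toCompleted _
    zero_le_one _ a x

theorem star_innerL (x y : P.Completed) : star (P.innerL x y) = P.innerL y x := by
  refine P.denseRange_toCompleted.induction_on₂ (p := fun x y => star (P.innerL x y) = P.innerL y x)
    ?_ ?_ x y
  · exact isClosed_eq P.continuous_innerL.star (P.continuous_innerL.comp continuous_swap)
  · intro x y
    rw [innerL_mk, innerL_mk, P.star_inner]

theorem norm_sq (x : P.Completed) : ‖x‖ ^ 2 = ‖P.innerL x x‖ := by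
  refine P.denseRange_toCompleted.induction_on (p := fun x => ‖x‖ ^ 2 = ‖P.innerL x x‖) x ?_ fun x => ?_
  · exact isClosed_eq (by fun_prop) (P.continuous_innerL.comp (continuous_id.prodMk continuous_id)).norm
  · rw [innerL_mk, norm_toCompleted, seminorm_sq]

theorem innerL_actL (x y : P.Completed) (a : A) :
    P.innerL x (P.actL y a) = P.innerL x y * a := by
  refine P.denseRange_incl.induction_on (p := fun a => P.innerL x (P.actL y a) = P.innerL x y * a)
    a (isClosed_eq (by fun_prop) (by fun_prop)) fun a => ?_
  refine P.denseRange_toCompleted.induction_on₂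
    (p := fun x y => P.innerL x (P.actL y (P.incl a)) = P.innerL x y * P.incl a) ?_ ?_ x y
  · have h : Continuous fun q : P.Completed × P.Completed => P.actL q.2 (P.incl a) :=
      P.actL.continuous₂.comp (continuous_snd.prodMk continuous_const)
    exact isClosed_eq (P.continuous_innerL.comp (continuous_fst.prodMk h))
      (P.continuous_innerL.mul continuous_const)
  · intro x y
    rw [actL_mk, innerL_mk, innerL_mk, P.inner_act]

theorem ext_innerL {y z : P.Completed} (h : ∀ x, P.innerL x y = P.innerL x z) : y = z := by
  have h1 : P.innerL (y - z) (y - z) = 0 := by rw [map_sub, h, sub_self]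
  have h2 := P.norm_sq (y - z)
  rw [h1, norm_zero] at h2
  exact sub_eq_zero.1 (norm_eq_zero.1 (pow_eq_zero_iff two_ne_zero |>.1 h2))

/-- The C⋆-correspondence obtained by completing a pre-Hilbert module `P` on which the dense
subalgebra `A₀` acts from the left by a bounded ⋆-representation `φ`. -/
def toCorrespondence (φ : A₀ →ₙₐ[ℂ] Module.End ℂ M)
    (hφ : ∀ a x, P.seminorm (φ a x) ≤ ‖P.incl a‖ * P.seminorm x)
    (hadj : ∀ a x y, P.inner (φ a x) y = P.inner x (φ (star a) y)) :
    Correspondence.{u, v} A where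
  carrier := P.Completed
  inner :=
    { toFun := fun x => (P.innerL x : P.Completed →ₗ[ℂ] A)
      map_add' := fun x y => by ext; simp
      map_smul' := fun c x => by ext; simp }
  act :=
    { toFun := fun x => (P.actL x : A →ₗ[ℂ] P.Completed)
      map_add' := fun x y => by ext; simp
      map_smul' := fun c x => by ext; simp }
  left :=
    { toFun := P.leftL φ hφ
      map_smul' := fun c a => map_smul _ c a
      map_zero' := map_zero _
      map_add' := map_add _
      map_mul' := fun a b => by
        refine P.denseRange_incl.induction_on₂
          (p := fun a b => P.leftL φ hφ (a * b) = P.leftL φ hφ a * P.leftL φ hφ b) ?_ ?_ a b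
        · exact isClosed_eq (by fun_prop) (by fun_prop)
        · intro a b
          refine ContinuousLinearMap.coeFn_injective (P.denseRange_toCompleted.equalizer
            (ContinuousLinearMap.continuous _) (ContinuousLinearMap.continuous _) ?_)
          ext x
          simp only [Function.comp_apply]
          change P.leftL φ hφ (P.incl a * P.incl b) (P.toCompleted x) =
            P.leftL φ hφ (P.incl a) (P.leftL φ hφ (P.incl b) (P.toCompleted x))
          rw [← map_mul, leftL_mk, map_mul, leftL_mk, leftL_mk]
          rfl }
  star_inner := P.star_innerL
  inner_self_nonneg x := by
    let _ := CStarAlgebra.spectralOrder A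
    let _ := CStarAlgebra.spectralOrderedRing A
    rw [← CStarAlgebra.nonneg_iff_eq_star_mul_self]
    refine P.denseRange_toCompleted.induction_on (p := fun x => 0 ≤ P.innerL x x) x ?_ fun x => ?_
    · exact isClosed_le continuous_const
        (P.continuous_innerL.comp (continuous_id.prodMk continuous_id))
    · rw [innerL_mk]
      exact CStarAlgebra.nonneg_iff_eq_star_mul_self.2 (P.inner_self_nonneg x)
  norm_sq := P.norm_sq
  act_act x a b := P.ext_innerL fun w => by
    change P.innerL w (P.actL (P.actL x a) b) = P.innerL w (P.actL x (a * b))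
    rw [innerL_actL, innerL_actL, innerL_actL, mul_assoc]
  inner_act := P.innerL_actL
  inner_left a x y := by
    change P.innerL (P.leftL φ hφ a x) y = P.innerL x (P.leftL φ hφ (star a) y)
    refine P.denseRange_incl.induction_on (p := fun a => P.innerL (P.leftL φ hφ a x) y =
      P.innerL x (P.leftL φ hφ (star a) y)) a (isClosed_eq ?_ ?_) fun a => ?_
    · exact P.continuous_innerL.comp (Continuous.prodMk (by fun_prop) continuous_const)
    · exact P.continuous_innerL.comp (Continuous.prodMk continuous_const
        ((P.leftL φ hφ).continuous₂.comp (continuous_star.prodMk continuous_const)))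
    refine P.denseRange_toCompleted.induction_on₂ (p := fun x y => P.innerL (P.leftL φ hφ (P.incl a) x) y =
      P.innerL x (P.leftL φ hφ (star (P.incl a)) y)) ?_ ?_ x y
    · have h1 : Continuous fun q : P.Completed × P.Completed => P.leftL φ hφ (P.incl a) q.1 :=
        (P.leftL φ hφ (P.incl a)).continuous.comp continuous_fst
      have h2 : Continuous fun q : P.Completed × P.Completed =>
          P.leftL φ hφ (star (P.incl a)) q.2 :=
        (P.leftL φ hφ (star (P.incl a))).continuous.comp continuous_snd
      exact isClosed_eq (P.continuous_innerL.comp (h1.prodMk continuous_snd))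
        (P.continuous_innerL.comp (continuous_fst.prodMk h2))
    · intro x y
      rw [← map_star, leftL_mk, leftL_mk, innerL_mk, innerL_mk, hadj]

end PreHilbertModule

/-! ### The external tensor product of two correspondences -/

namespace Correspondence

variable {A : Type*} [NonUnitalCStarAlgebra A] {B : Type*} [NonUnitalCStarAlgebra B]

theorem exists_negPart {T : Type*} [NonUnitalCStarAlgebra T] {G : T} (hG : IsSelfAdjoint G) :
    ∃ N e : T, N = star e * e ∧ N * G * N = -(star (e * N) * (e * N)) ∧
      (e * N = 0 → ∃ c, G = star c * c) := by
  let _ := CStarAlgebra.spectralOrder T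
  let _ := CStarAlgebra.spectralOrderedRing T
  have hN0 : 0 ≤ G⁻ := CFC.negPart_nonneg G
  have hNsa : star G⁻ = G⁻ := hN0.isSelfAdjoint
  obtain ⟨e, he⟩ := CStarAlgebra.nonneg_iff_eq_star_mul_self.1 hN0
  refine ⟨G⁻, e, he, ?_, fun hzero => ?_⟩
  · have h1 : G⁻ * G = -(G⁻ * G⁻) := by
      conv_lhs => enter [2]; rw [← CFC.posPart_sub_negPart G hG]
      rw [mul_sub, CFC.negPart_mul_posPart, zero_sub]
    rw [h1, star_mul, hNsa]
    rw [neg_mul, mul_assoc G⁻ (star e), ← mul_assoc (star e), ← he, mul_assoc]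
  · have h7 : G⁻ * G⁻ = 0 := by
      conv_lhs => enter [1]; rw [he]
      rw [mul_assoc, hzero, mul_zero]
    have h8 : G⁻ = 0 := by
      rw [← CStarRing.star_mul_self_eq_zero_iff, hNsa, h7]
    rw [← CStarAlgebra.nonneg_iff_eq_star_mul_self, ← CFC.posPart_sub_negPart G hG, h8, sub_zero]
    exact CFC.posPart_nonneg G

/-- The Gram matrix of a finite family in a Hilbert module is of the form `star c * c`. -/
theorem exists_gram (X : Correspondence A) {ι : Type*} [Fintype ι] (x : ι → X.carrier) :
    ∃ c : ι → ι → A, ∀ i j, X.inner (x i) (x j) = ∑ k, star (c k i) * c k j := by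
  let _ := CStarAlgebra.spectralOrder A
  let _ := CStarAlgebra.spectralOrderedRing A
  let G : CStarMatrix ι ι A := CStarMatrix.ofMatrix fun i j => X.inner (x i) (x j)
  have hG : ∀ i j, G i j = X.inner (x i) (x j) := fun _ _ => rfl
  have hGsa : IsSelfAdjoint G := by
    ext i j
    rw [CStarMatrix.star_apply, hG, hG, X.star_inner]
  obtain ⟨N, e, he, hNGN, hpos⟩ := exists_negPart hGsa
  have hNsa : star N = N := by rw [he, star_mul, star_star]
  have hzero : e * N = 0 := by
    have hdiag : ∀ j, ∑ k, star ((e * N) k j) * (e * N) k j = 0 := by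
      intro j
      refine le_antisymm ?_ (Finset.sum_nonneg fun k _ => star_mul_self_nonneg _)
      have h2 := congrArg (fun T : CStarMatrix ι ι A => T j j) hNGN
      simp only [CStarMatrix.neg_apply] at h2
      have h3 : (star (e * N) * (e * N)) j j = ∑ k, star ((e * N) k j) * (e * N) k j := by
        rw [CStarMatrix.mul_apply]
        rfl
      have h4 : (N * G * N) j j =
          X.inner (∑ k, X.act (x k) (N k j)) (∑ k, X.act (x k) (N k j)) := by
        have hl : ∀ y z a, X.inner (X.act y a) z = star a * X.inner y z := fun y z a => by
          rw [← X.star_inner, X.inner_act, star_mul, X.star_inner]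
        have hs : ∀ i k, star (N i k) = N k i := fun i k => by
          rw [← CStarMatrix.star_apply, hNsa]
        rw [CStarMatrix.mul_apply]
        simp only [CStarMatrix.mul_apply, map_sum, LinearMap.sum_apply, X.inner_act, hl, hs, hG,
          Finset.sum_mul, mul_assoc]
      have h5 : 0 ≤ (N * G * N) j j := by
        rw [h4]
        exact CStarAlgebra.nonneg_iff_eq_star_mul_self.2 (X.inner_self_nonneg _)
      rw [h2, h3] at h5
      exact neg_nonneg.1 h5
    ext k j
    have h6 := (Finset.sum_eq_zero_iff_of_nonneg
      (fun k _ => star_mul_self_nonneg ((e * N) k j))).1 (hdiag j) k (Finset.mem_univ k)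
    exact CStarRing.star_mul_self_eq_zero_iff _ |>.1 h6
  obtain ⟨c, hc⟩ := hpos hzero
  refine ⟨fun i j => c i j, fun i j => ?_⟩
  rw [← hG, hc, CStarMatrix.mul_apply]
  rfl

variable (X : Correspondence A) (Y : Correspondence B)

/-- The inner product `⟨x ⊗ y, x' ⊗ y'⟩ = ⟨x, x'⟩ ⊗ ⟨y, y'⟩` on the algebraic tensor product. -/
def tensorInner : X.carrier ⊗[ℂ] Y.carrier →ₗ⋆[ℂ] X.carrier ⊗[ℂ] Y.carrier →ₗ[ℂ] CStarTensor A B :=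
  (TensorProduct.map₂ X.inner Y.inner).compr₂ₛₗ (CStarTensor.ofAlg A B)

theorem tensorInner_tmul (x x' : X.carrier) (y y' : Y.carrier) :
    tensorInner X Y (x ⊗ₜ y) (x' ⊗ₜ y') =
      CStarTensor.ofAlg A B (X.inner x x' ⊗ₜ Y.inner y y') := rfl

theorem star_tensorInner (s t : X.carrier ⊗[ℂ] Y.carrier) :
    star (tensorInner X Y s t) = tensorInner X Y t s := by
  induction s using TensorProduct.induction_on with
  | zero => simp
  | add s s' hs hs' => simp [hs, hs']
  | tmul x y =>
    induction t using TensorProduct.induction_on with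
    | zero => simp
    | add t t' ht ht' => simp [ht, ht']
    | tmul x' y' =>
      rw [tensorInner_tmul, tensorInner_tmul, ← CStarTensor.ofAlg_star, TensorProduct.star_tmul,
        X.star_inner, Y.star_inner]

theorem tensorInner_self_nonneg (t : X.carrier ⊗[ℂ] Y.carrier) :
    ∃ a, tensorInner X Y t t = star a * a := by
  let _ := CStarAlgebra.spectralOrder (CStarTensor A B)
  let _ := CStarAlgebra.spectralOrderedRing (CStarTensor A B)
  obtain ⟨S, hS⟩ := TensorProduct.exists_finset t
  have ht : t = ∑ i : S, i.1.1 ⊗ₜ[ℂ] i.1.2 := by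
    rw [hS]
    exact (Finset.sum_coe_sort S fun i => i.1 ⊗ₜ[ℂ] i.2).symm
  obtain ⟨c, hc⟩ := X.exists_gram fun i : S => i.1.1
  obtain ⟨d, hd⟩ := Y.exists_gram fun i : S => i.1.2
  rw [← CStarAlgebra.nonneg_iff_eq_star_mul_self]
  have key : tensorInner X Y t t = ∑ k : S, ∑ l : S,
      star (CStarTensor.ofAlg A B (∑ i : S, c k i ⊗ₜ[ℂ] d l i)) *
        CStarTensor.ofAlg A B (∑ i : S, c k i ⊗ₜ[ℂ] d l i) := by
    have h1 : ∀ k l : S, star (CStarTensor.ofAlg A B (∑ i : S, c k i ⊗ₜ[ℂ] d l i)) *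
        CStarTensor.ofAlg A B (∑ i : S, c k i ⊗ₜ[ℂ] d l i) = CStarTensor.ofAlg A B
          (∑ i : S, ∑ j : S, (star (c k i) * c k j) ⊗ₜ[ℂ] (star (d l i) * d l j)) := by
      intro k l
      rw [← CStarTensor.ofAlg_star, ← CStarTensor.ofAlg_mul]
      simp only [star_sum, TensorProduct.star_tmul, Finset.sum_mul, Finset.mul_sum,
        Algebra.TensorProduct.tmul_mul_tmul]
      rw [Finset.sum_comm]
    simp only [h1, ← map_sum]
    rw [ht]
    simp only [map_sum, LinearMap.sum_apply, tensorInner_tmul, hc, hd, TensorProduct.sum_tmul,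
      TensorProduct.tmul_sum]
    rw [Finset.sum_comm_cycle, Finset.sum_congr rfl fun l _ => Finset.sum_comm_cycle,
      Finset.sum_comm]
    exact Finset.sum_congr rfl fun k _ => Finset.sum_congr rfl fun l _ => Finset.sum_comm
  rw [key]
  exact Finset.sum_nonneg fun k _ => Finset.sum_nonneg fun l _ => star_mul_self_nonneg _

/-- The algebraic tensor product `X ⊙ Y` as a right module over `A ⊙ B`, with
`(x ⊗ y) · (a ⊗ b) = x · a ⊗ y · b` and `⟨x ⊗ y, x' ⊗ y'⟩ = ⟨x, x'⟩ ⊗ ⟨y, y'⟩`. -/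
def tensorPre : PreHilbertModule (A ⊗[ℂ] B) (CStarTensor A B) (X.carrier ⊗[ℂ] Y.carrier) where
  incl := CStarTensor.incl A B
  denseRange_incl := CStarTensor.denseRange_incl
  inner := tensorInner X Y
  act := TensorProduct.map₂ X.act Y.act
  star_inner := star_tensorInner X Y
  inner_self_nonneg := tensorInner_self_nonneg X Y
  inner_act s t r := by
    change tensorInner X Y s (TensorProduct.map₂ X.act Y.act t r) =
      tensorInner X Y s t * CStarTensor.ofAlg A B r
    induction r using TensorProduct.induction_on with
    | zero => simp
    | add r r' hr hr' => simp [hr, hr', mul_add]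
    | tmul a b =>
      induction s using TensorProduct.induction_on with
      | zero => simp
      | add s s' hs hs' => simp [hs, hs', add_mul]
      | tmul x y =>
        induction t using TensorProduct.induction_on with
        | zero => simp
        | add t t' ht ht' => simp [ht, ht', add_mul]
        | tmul x' y' =>
          rw [TensorProduct.map₂_apply_tmul, TensorProduct.map_tmul, tensorInner_tmul,
            tensorInner_tmul, ← CStarTensor.ofAlg_mul, Algebra.TensorProduct.tmul_mul_tmul,
            X.inner_act, Y.inner_act]

/-- The left action `(a ⊗ b) · (x ⊗ y) = a · x ⊗ b · y` on the algebraic tensor product. -/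
def tensorLeft : A ⊗[ℂ] B →ₙₐ[ℂ] Module.End ℂ (X.carrier ⊗[ℂ] Y.carrier) where
  toFun := TensorProduct.map₂
    ((ContinuousLinearMap.coeLM ℂ).comp (X.left : A →ₗ[ℂ] X.carrier →L[ℂ] X.carrier))
    ((ContinuousLinearMap.coeLM ℂ).comp (Y.left : B →ₗ[ℂ] Y.carrier →L[ℂ] Y.carrier))
  map_smul' c t := map_smul _ c t
  map_zero' := map_zero _
  map_add' := map_add _
  map_mul' s t := by
    induction s using TensorProduct.induction_on with
    | zero => simp
    | add s s' hs hs' => simp [hs, hs', add_mul]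
    | tmul a b =>
      induction t using TensorProduct.induction_on with
      | zero => simp
      | add t t' ht ht' => simp [ht, ht', mul_add]
      | tmul a' b' => ext x y; simp

theorem tensorLeft_tmul (a : A) (b : B) (x : X.carrier) (y : Y.carrier) :
    tensorLeft X Y (a ⊗ₜ b) (x ⊗ₜ y) = X.left a x ⊗ₜ Y.left b y := rfl

theorem tensorLeft_adjoint (r : A ⊗[ℂ] B) (s t : X.carrier ⊗[ℂ] Y.carrier) :
    tensorInner X Y (tensorLeft X Y r s) t = tensorInner X Y s (tensorLeft X Y (star r) t) := by
  induction r using TensorProduct.induction_on with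
  | zero => simp
  | add r r' hr hr' => simp [hr, hr']
  | tmul a b =>
    induction s using TensorProduct.induction_on with
    | zero => simp
    | add s s' hs hs' => simp only [map_add, LinearMap.add_apply, hs, hs']
    | tmul x y =>
      induction t using TensorProduct.induction_on with
      | zero => simp
      | add t t' ht ht' => simp only [map_add, ht, ht']
      | tmul x' y' =>
        rw [TensorProduct.star_tmul, tensorLeft_tmul, tensorLeft_tmul, tensorInner_tmul,
          tensorInner_tmul, X.inner_left, Y.inner_left]

theorem seminorm_tensorLeft_tmul_le (a : A) (b : B) (t : X.carrier ⊗[ℂ] Y.carrier) :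
    (tensorPre X Y).seminorm (tensorLeft X Y (a ⊗ₜ b) t) ≤
      ‖a‖ * ‖b‖ * (tensorPre X Y).seminorm t := by
  let φ : A →ₙₐ[ℂ] Module.End ℂ (X.carrier ⊗[ℂ] Y.carrier) :=
    { toFun := fun a => (X.left a : X.carrier →ₗ[ℂ] X.carrier).rTensor Y.carrier
      map_smul' := fun c a => by ext; simp [TensorProduct.smul_tmul']
      map_zero' := by ext; simp
      map_add' := fun a b => by ext; simp
      map_mul' := fun a b => by ext; simp }
  let χ : B →ₙₐ[ℂ] Module.End ℂ (X.carrier ⊗[ℂ] Y.carrier) :=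
    { toFun := fun b => (Y.left b : Y.carrier →ₗ[ℂ] Y.carrier).lTensor X.carrier
      map_smul' := fun c a => by ext; simp
      map_zero' := by ext; simp
      map_add' := fun a b => by ext; simp
      map_mul' := fun a b => by ext; simp }
  have hφ : ∀ c s t, (tensorPre X Y).inner (φ c s) t = (tensorPre X Y).inner s (φ (star c) t) := by
    intro c s t
    change tensorInner X Y _ _ = tensorInner X Y _ _
    induction s using TensorProduct.induction_on with
    | zero => simp
    | add s s' hs hs' => simp only [map_add, LinearMap.add_apply, hs, hs']
    | tmul x y =>
      induction t using TensorProduct.induction_on with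
      | zero => simp
      | add t t' ht ht' => simp only [map_add, ht, ht']
      | tmul x' y' =>
        change tensorInner X Y (X.left c x ⊗ₜ y) (x' ⊗ₜ y') =
          tensorInner X Y (x ⊗ₜ y) (X.left (star c) x' ⊗ₜ y')
        rw [tensorInner_tmul, tensorInner_tmul, X.inner_left]
  have hχ : ∀ c s t, (tensorPre X Y).inner (χ c s) t = (tensorPre X Y).inner s (χ (star c) t) := by
    intro c s t
    change tensorInner X Y _ _ = tensorInner X Y _ _
    induction s using TensorProduct.induction_on with
    | zero => simp
    | add s s' hs hs' => simp only [map_add, LinearMap.add_apply, hs, hs']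
    | tmul x y =>
      induction t using TensorProduct.induction_on with
      | zero => simp
      | add t t' ht ht' => simp only [map_add, ht, ht']
      | tmul x' y' =>
        change tensorInner X Y (x ⊗ₜ Y.left c y) (x' ⊗ₜ y') =
          tensorInner X Y (x ⊗ₜ y) (x' ⊗ₜ Y.left (star c) y')
        rw [tensorInner_tmul, tensorInner_tmul, Y.inner_left]
  have h : tensorLeft X Y (a ⊗ₜ b) t = φ a (χ b t) := by
    induction t using TensorProduct.induction_on with
    | zero => simp
    | add t t' ht ht' => simp only [map_add, ht, ht']
    | tmul x y => rfl
  rw [h, mul_assoc]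
  exact ((tensorPre X Y).seminorm_left_le φ hφ a _).trans
    (mul_le_mul_of_nonneg_left ((tensorPre X Y).seminorm_left_le χ hχ b t) (norm_nonneg a))

theorem exists_tensorLeft_bound (r : A ⊗[ℂ] B) :
    ∃ C, ∀ t, ‖(tensorPre X Y).toCompleted (tensorLeft X Y r t)‖ ≤
      C * ‖(tensorPre X Y).toCompleted t‖ := by
  simp only [(tensorPre X Y).norm_toCompleted]
  induction r using TensorProduct.induction_on with
  | zero => exact ⟨0, fun t => by simp⟩
  | tmul a b => exact ⟨_, seminorm_tensorLeft_tmul_le X Y a b⟩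
  | add r r' hr hr' =>
    obtain ⟨C, hC⟩ := hr
    obtain ⟨D, hD⟩ := hr'
    refine ⟨C + D, fun t => ?_⟩
    rw [map_add, LinearMap.add_apply, add_mul]
    exact (map_add_le_add _ _ _).trans (add_le_add (hC t) (hD t))

/-- The operators on the completion of the algebraic tensor product given by the left action. -/
def tensorOp : A ⊗[ℂ] B →ₗ[ℂ] (tensorPre X Y).Completed →L[ℂ] (tensorPre X Y).Completed where
  toFun r := ((tensorPre X Y).toCompleted.comp (tensorLeft X Y r)).extendOfNorm
    (tensorPre X Y).toCompleted
  map_add' r s := by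
    refine ContinuousLinearMap.coeFn_injective ((tensorPre X Y).denseRange_toCompleted.equalizer
      (ContinuousLinearMap.continuous _) (ContinuousLinearMap.continuous _) ?_)
    ext t
    simp only [Function.comp_apply, _root_.add_apply]
    rw [LinearMap.extendOfNorm_eq (tensorPre X Y).denseRange_toCompleted
        (exists_tensorLeft_bound X Y _),
      LinearMap.extendOfNorm_eq (tensorPre X Y).denseRange_toCompleted
        (exists_tensorLeft_bound X Y _),
      LinearMap.extendOfNorm_eq (tensorPre X Y).denseRange_toCompleted
        (exists_tensorLeft_bound X Y _)]
    simp
  map_smul' c r := by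
    refine ContinuousLinearMap.coeFn_injective ((tensorPre X Y).denseRange_toCompleted.equalizer
      (ContinuousLinearMap.continuous _) (ContinuousLinearMap.continuous _) ?_)
    ext t
    simp only [Function.comp_apply, _root_.smul_apply]
    rw [LinearMap.extendOfNorm_eq (tensorPre X Y).denseRange_toCompleted
        (exists_tensorLeft_bound X Y _),
      LinearMap.extendOfNorm_eq (tensorPre X Y).denseRange_toCompleted
        (exists_tensorLeft_bound X Y _)]
    simp

theorem tensorOp_apply (r : A ⊗[ℂ] B) (t : X.carrier ⊗[ℂ] Y.carrier) :
    tensorOp X Y r ((tensorPre X Y).toCompleted t) =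
      (tensorPre X Y).toCompleted (tensorLeft X Y r t) :=
  LinearMap.extendOfNorm_eq (tensorPre X Y).denseRange_toCompleted
        (exists_tensorLeft_bound X Y r) t

theorem seminorm_tensorLeft_le (r : A ⊗[ℂ] B) (t : X.carrier ⊗[ℂ] Y.carrier) :
    (tensorPre X Y).seminorm (tensorLeft X Y r t) ≤
      ‖tensorOp X Y r‖ * (tensorPre X Y).seminorm t := by
  rw [← (tensorPre X Y).norm_toCompleted, ← (tensorPre X Y).norm_toCompleted, ← tensorOp_apply]
  exact ContinuousLinearMap.le_opNorm _ _

theorem norm_tensorOp_le (r : A ⊗[ℂ] B) (C : ℝ) (hC : 0 ≤ C)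
    (h : ∀ t, (tensorPre X Y).seminorm (tensorLeft X Y r t) ≤ C * (tensorPre X Y).seminorm t) :
    ‖tensorOp X Y r‖ ≤ C :=
  LinearMap.opNorm_extendOfNorm_le (tensorPre X Y).denseRange_toCompleted hC fun t => by
    rw [(tensorPre X Y).norm_toCompleted]
    exact ((tensorPre X Y).norm_toCompleted _).trans_le (h t)

theorem isCStarSeminorm_tensorOp :
    IsCStarSeminorm ((normSeminorm ℂ _).comp (tensorOp X Y)) := by
  have hmul : ∀ r s, ‖tensorOp X Y (r * s)‖ ≤ ‖tensorOp X Y r‖ * ‖tensorOp X Y s‖ := by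
    refine fun r s => norm_tensorOp_le X Y _ _ (by positivity) fun t => ?_
    rw [map_mul, mul_assoc]
    exact (seminorm_tensorLeft_le X Y r _).trans
      (mul_le_mul_of_nonneg_left (seminorm_tensorLeft_le X Y s t) (norm_nonneg _))
  have hsq : ∀ r, ‖tensorOp X Y r‖ ^ 2 ≤ ‖tensorOp X Y (star r * r)‖ := by
    intro r
    rw [← Real.le_sqrt (norm_nonneg _) (norm_nonneg _)]
    refine norm_tensorOp_le X Y _ _ (by positivity) fun t => ?_
    refine Real.sqrt_le_iff.2 ⟨by positivity, ?_⟩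
    change ‖tensorInner X Y _ _‖ ≤ _
    rw [tensorLeft_adjoint, ← Module.End.mul_apply, ← map_mul, mul_pow,
      Real.sq_sqrt (norm_nonneg _)]
    have h1 := (tensorPre X Y).norm_inner_le t (tensorLeft X Y (star r * r) t)
    refine h1.trans ?_
    change (tensorPre X Y).seminorm t * (tensorPre X Y).seminorm _ ≤ _
    have h2 := mul_le_mul_of_nonneg_left (seminorm_tensorLeft_le X Y (star r * r) t)
      (apply_nonneg (tensorPre X Y).seminorm t)
    refine h2.trans_eq ?_
    ring
  have hstar : ∀ r, ‖tensorOp X Y r‖ ≤ ‖tensorOp X Y (star r)‖ := by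
    intro r
    rcases (norm_nonneg (tensorOp X Y r)).eq_or_lt with h | h
    · rw [← h]; exact norm_nonneg _
    · have := (hsq r).trans (hmul (star r) r)
      rw [sq] at this
      exact le_of_mul_le_mul_right this h
  refine ⟨hmul, fun r => le_antisymm ?_ (hsq r), fun a b => ?_⟩
  · have h1 := hstar (star r)
    rw [star_star] at h1
    refine (hmul (star r) r).trans ?_
    change _ ≤ ‖tensorOp X Y r‖ ^ 2
    rw [sq]
    exact mul_le_mul_of_nonneg_right h1 (norm_nonneg _)
  · exact norm_tensorOp_le X Y _ _ (by positivity) (seminorm_tensorLeft_tmul_le X Y a b)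

theorem tensorLeft_bounded (r : A ⊗[ℂ] B) (t : X.carrier ⊗[ℂ] Y.carrier) :
    (tensorPre X Y).seminorm (tensorLeft X Y r t) ≤
      ‖(tensorPre X Y).incl r‖ * (tensorPre X Y).seminorm t := by
  refine (seminorm_tensorLeft_le X Y r t).trans
    (mul_le_mul_of_nonneg_right ?_ (apply_nonneg _ _))
  exact ((isCStarSeminorm_tensorOp X Y).le_tensorSeminorm r).trans_eq (CStarTensor.norm_incl r).symm

/-- The external tensor product `X ⊗ Y`, a correspondence over `A ⊗ B`: the completion of the
algebraic tensor product, with the left action `(a ⊗ b) · (x ⊗ y) = a · x ⊗ b · y`. -/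
def externalTensor : Correspondence (CStarTensor A B) :=
  (tensorPre X Y).toCorrespondence (tensorLeft X Y) (tensorLeft_bounded X Y)
    (tensorLeft_adjoint X Y)

/-- For subspaces `I` of `A` and `J` of `B` (such as closed ideals), the closed linear span
`I ⊗ J` of the elementary tensors `a ⊗ b` with `a ∈ I` and `b ∈ J`, inside `A ⊗ B`. -/
def tensorSubmodule (I : Submodule ℂ A) (J : Submodule ℂ B) : Submodule ℂ (CStarTensor A B) :=
  (Submodule.span ℂ {t | ∃ a ∈ I, ∃ b ∈ J, CStarTensor.incl A B (a ⊗ₜ[ℂ] b) = t}).topologicalClosure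

/-- Two correspondences are ideal-compatible if `J_{X ⊗ Y} = J_X ⊗ J_Y`. -/
def IdealCompatible : Prop :=
  (externalTensor X Y).katsuraIdeal = tensorSubmodule X.katsuraIdeal Y.katsuraIdeal

end Correspondence

/-! ### The correspondence of a directed graph -/

/-- A directed graph with vertex set `V` and edge set `E`; the edge `e` goes from `s e` to `r e`.
Loops and multiple edges are allowed. -/
structure DirectedGraph (V : Type*) (E : Type*) where
  /-- The range of an edge. -/
  r : E → V
  /-- The source of an edge. -/
  s : E → V

namespace DirectedGraph

/-- The function `e ↦ x e * w e`. -/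
def mulFun {E : Type*} (w : E → ℂ) : (E →₀ ℂ) →ₗ[ℂ] E →₀ ℂ where
  toFun x := Finsupp.onFinset x.support (fun e => x e * w e) fun e h =>
    Finsupp.mem_support_iff.2 (left_ne_zero_of_mul h)
  map_add' x y := by ext e; simp [add_mul]
  map_smul' c x := by ext e; simp [mul_assoc]

theorem mulFun_apply {E : Type*} (w : E → ℂ) (x : E →₀ ℂ) (e : E) : mulFun w x e = x e * w e := rfl

variable {V : Type u} {E : Type v} [TopologicalSpace V] [DiscreteTopology V]
  (G : DirectedGraph V E)

open Classical in
/-- The inner product `⟨x, y⟩ v = ∑_{s e = v} conj (x e) * y e` of two finitely supported functions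
on the edges, as an element of `c₀(V)`. -/
def innerFun (x y : E →₀ ℂ) : C₀(V, ℂ) where
  toFun v := ∑ e ∈ x.support with G.s e = v, conj (x e) * y e
  continuous_toFun := continuous_of_discreteTopology
  zero_at_infty' := by
    rw [Filter.cocompact_eq_cofinite]
    refine tendsto_nhds_of_eventually_eq ?_
    filter_upwards [(x.support.image G.s).finite_toSet.compl_mem_cofinite] with v hv
    refine Finset.sum_eq_zero fun e he => ?_
    rw [Finset.mem_filter] at he
    exact absurd (Finset.mem_coe.2 (Finset.mem_image.2 ⟨e, he.1, he.2⟩)) hv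

open Classical in
theorem innerFun_apply_of_subset (x y : E →₀ ℂ) (S : Finset E) (hS : x.support ⊆ S) (v : V) :
    G.innerFun x y v = ∑ e ∈ S with G.s e = v, conj (x e) * y e := by
  refine Finset.sum_subset (Finset.filter_subset_filter _ hS) fun e he he' => ?_
  rw [Finset.mem_filter] at he he'
  have : x e = 0 := by
    by_contra h
    exact he' ⟨Finsupp.mem_support_iff.2 h, he.2⟩
  simp [this]

open Classical in
theorem exists_innerFun_self (x : E →₀ ℂ) : ∃ a : C₀(V, ℂ), G.innerFun x x = star a * a := by
  refine ⟨⟨⟨fun v => (√(∑ e ∈ x.support with G.s e = v, ‖x e‖ ^ 2) : ℂ),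
    continuous_of_discreteTopology⟩, ?_⟩, ?_⟩
  · rw [Filter.cocompact_eq_cofinite]
    refine tendsto_nhds_of_eventually_eq ?_
    filter_upwards [(x.support.image G.s).finite_toSet.compl_mem_cofinite] with v hv
    rw [Finset.sum_eq_zero, Real.sqrt_zero, Complex.ofReal_zero]
    intro e he
    rw [Finset.mem_filter] at he
    exact absurd (Finset.mem_coe.2 (Finset.mem_image.2 ⟨e, he.1, he.2⟩)) hv
  · ext v
    change (∑ e ∈ x.support with G.s e = v, conj (x e) * x e) =
      conj (√(∑ e ∈ x.support with G.s e = v, ‖x e‖ ^ 2) : ℂ) *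
        (√(∑ e ∈ x.support with G.s e = v, ‖x e‖ ^ 2) : ℂ)
    rw [Complex.conj_ofReal, ← Complex.ofReal_mul, Real.mul_self_sqrt
      (Finset.sum_nonneg fun e _ => by positivity), Complex.ofReal_sum]
    exact Finset.sum_congr rfl fun e _ => by simp [Complex.conj_mul']

/-- The space `c_c(E)` of finitely supported functions on the edges, with the inner product above
and the right action `(x · a) e = x e * a (s e)` of `c₀(V)`. -/
def preHilbert : PreHilbertModule C₀(V, ℂ) C₀(V, ℂ) (E →₀ ℂ) where
  incl := NonUnitalStarAlgHom.id ℂ _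
  denseRange_incl := Function.surjective_id.denseRange
  inner := LinearMap.mk₂'ₛₗ _ _ G.innerFun
    (fun x x' y => by
      classical
      ext v
      rw [ZeroAtInftyContinuousMap.add_apply,
        G.innerFun_apply_of_subset _ y (x.support ∪ x'.support) Finsupp.support_add,
        G.innerFun_apply_of_subset x y (x.support ∪ x'.support) Finset.subset_union_left,
        G.innerFun_apply_of_subset x' y (x.support ∪ x'.support) Finset.subset_union_right,
        ← Finset.sum_add_distrib]
      exact Finset.sum_congr rfl fun e _ => by simp [add_mul])
    (fun c x y => by
      classical
      ext v
      rw [ZeroAtInftyContinuousMap.smul_apply,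
        G.innerFun_apply_of_subset _ y x.support Finsupp.support_smul,
        G.innerFun_apply_of_subset x y x.support subset_rfl, Finset.smul_sum]
      exact Finset.sum_congr rfl fun e _ => by simp [mul_assoc])
    (fun x y y' => by
      classical
      ext v
      simp [innerFun, mul_add, Finset.sum_add_distrib])
    (fun c x y => by
      classical
      ext v
      simp [innerFun, Finset.mul_sum, mul_left_comm])
  act := LinearMap.mk₂ ℂ (fun x a => mulFun (fun e => a (G.s e)) x)
    (fun x y a => map_add _ x y) (fun c x a => map_smul _ c x)
    (fun x a b => by ext e; simp [mulFun_apply, mul_add])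
    (fun c x a => by ext e; simp [mulFun_apply, mul_left_comm])
  star_inner x y := by
    classical
    ext v
    change conj (G.innerFun x y v) = G.innerFun y x v
    rw [G.innerFun_apply_of_subset x y (x.support ∪ y.support) Finset.subset_union_left,
      G.innerFun_apply_of_subset y x (x.support ∪ y.support) Finset.subset_union_right, map_sum]
    exact Finset.sum_congr rfl fun e _ => by simp [mul_comm]
  inner_self_nonneg := G.exists_innerFun_self
  inner_act x y a := by
    classical
    ext v
    change (∑ e ∈ x.support with G.s e = v, conj (x e) * (y e * a (G.s e))) =
      (∑ e ∈ x.support with G.s e = v, conj (x e) * y e) * a v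
    rw [Finset.sum_mul]
    refine Finset.sum_congr rfl fun e he => ?_
    rw [(Finset.mem_filter.1 he).2, mul_assoc]

/-- The left action `(a · x) e = a (r e) * x e` of `c₀(V)` on `c_c(E)`. -/
def leftAction : C₀(V, ℂ) →ₙₐ[ℂ] Module.End ℂ (E →₀ ℂ) where
  toFun a := mulFun fun e => a (G.r e)
  map_smul' c a := by ext; simp [mulFun_apply, mul_left_comm]
  map_zero' := by ext; simp [mulFun_apply]
  map_add' a b := by ext; simp [mulFun_apply, mul_add]
  map_mul' a b := by ext; simp [mulFun_apply, mul_assoc, mul_comm]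

theorem leftAction_adjoint (a : C₀(V, ℂ)) (x y : E →₀ ℂ) :
    G.preHilbert.inner (G.leftAction a x) y = G.preHilbert.inner x (G.leftAction (star a) y) := by
  classical
  ext v
  change G.innerFun (G.leftAction a x) y v = G.innerFun x (G.leftAction (star a) y) v
  have hS : (G.leftAction a x).support ⊆ x.support := fun e he => by
    rw [Finsupp.mem_support_iff] at he ⊢
    exact left_ne_zero_of_mul he
  rw [G.innerFun_apply_of_subset _ y x.support hS, G.innerFun_apply_of_subset x _ x.support
    subset_rfl]
  refine Finset.sum_congr rfl fun e _ => ?_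
  change conj (x e * a (G.r e)) * y e = conj (x e) * (y e * conj (a (G.r e)))
  rw [map_mul]
  ring

/-- The graph correspondence `X(G)` over `c₀(V)`: the completion of `c_c(E)`, with
`⟨x, y⟩ v = ∑_{s e = v} conj (x e) * y e`, `(x · a) e = x e * a (s e)` and
`(a · x) e = a (r e) * x e`. -/
def correspondence : Correspondence C₀(V, ℂ) :=
  G.preHilbert.toCorrespondence G.leftAction
    (G.preHilbert.seminorm_left_le G.leftAction G.leftAction_adjoint) G.leftAction_adjoint

end DirectedGraph

end CStarCorr

end

/-!
The ideals in question are closed spans of point masses. Write `p v` for the indicator function of a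
vertex `v`. The elements `p v ⊗ p w` of `c₀(V) ⊗ c₀(W)` are nonzero central projections, each
product `t * (p v ⊗ p w)` is a scalar multiple of `p v ⊗ p w`, and a closed subspace containing all
these products contains `t` (`mem_of_mul_tensorPointMass_mem`). Katsura ideals are closed right
ideals (`isClosed_katsuraIdeal`, `mul_mem_katsuraIdeal`), so both inclusions follow once it is known
that `p v ⊗ p w` lies in `J_{X ⊗ Y}` exactly when `p v` lies in `J_X` and `p w` in `J_Y`.

The indicator functions of the edges form an orthonormal basis of a graph correspondence, and their
elementary tensors form one of the external tensor product (`IsOrthonormalBasis.tensor`). On these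
bases, `p v` acts as the projection onto the edges in `r⁻¹(v)`, and `p v ⊗ p w` as the projection
onto `r⁻¹(v) × r⁻¹(w)`. A compact operator tends to zero along an orthonormal basis; therefore a
minimal projection that acts as the projection onto a set `R` of basis vectors lies in the Katsura
ideal exactly when `R` is finite and nonempty (`IsOrthonormalBasis.mem_katsuraIdeal_iff`). A product
of two sets is finite and nonempty exactly when both factors are, which proves the claim.
-/

namespace CStarCorr

open Correspondence

/-! ### Bounds and closedness in a correspondence -/

namespace Correspondence

section General

variable {A : Type*} [NonUnitalCStarAlgebra A] (X : Correspondence A)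

/-- The Hilbert module underlying a correspondence, before its left action is taken into account. -/
@[reducible] noncomputable def toPreHilbertModule : PreHilbertModule A A X.carrier where
  incl := NonUnitalStarAlgHom.id ℂ A
  denseRange_incl := Function.surjective_id.denseRange
  inner := X.inner
  act := X.act
  star_inner := X.star_inner
  inner_self_nonneg := X.inner_self_nonneg
  inner_act := X.inner_act

theorem seminorm_toPreHilbertModule (x : X.carrier) : X.toPreHilbertModule.seminorm x = ‖x‖ := by
  rw [PreHilbertModule.seminorm_apply, ← X.norm_sq, Real.sqrt_sq (norm_nonneg x)]

theorem norm_inner_le (x y : X.carrier) : ‖X.inner x y‖ ≤ ‖x‖ * ‖y‖ := by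
  have h := X.toPreHilbertModule.norm_inner_le x y
  rwa [← PreHilbertModule.seminorm_apply, ← PreHilbertModule.seminorm_apply,
    seminorm_toPreHilbertModule, seminorm_toPreHilbertModule] at h

theorem norm_act_le (x : X.carrier) (a : A) : ‖X.act x a‖ ≤ ‖x‖ * ‖a‖ := by
  have h := X.toPreHilbertModule.seminorm_act_le x a
  rwa [seminorm_toPreHilbertModule, seminorm_toPreHilbertModule] at h

theorem norm_left_le (a : A) : ‖X.left a‖ ≤ ‖a‖ := by
  refine ContinuousLinearMap.opNorm_le_bound _ (norm_nonneg a) fun x => ?_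
  let φ : A →ₙₐ[ℂ] Module.End ℂ X.carrier :=
    { toFun := fun a => (X.left a : X.carrier →ₗ[ℂ] X.carrier)
      map_smul' := fun c a => by ext; simp
      map_zero' := by ext; simp
      map_add' := fun a b => by ext; simp
      map_mul' := fun a b => by ext; simp }
  have h := X.toPreHilbertModule.seminorm_left_le φ X.inner_left a x
  rwa [seminorm_toPreHilbertModule, seminorm_toPreHilbertModule] at h

theorem continuous_left : Continuous X.left :=
  AddMonoidHomClass.continuous_of_bound X.left 1 fun a => by
    simpa using X.norm_left_le a

theorem isClosed_katsuraIdeal : IsClosed (X.katsuraIdeal : Set A) := by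
  have h : (X.katsuraIdeal : Set A) = X.left ⁻¹' (X.compacts : Set _) ∩
      ⋂ (b : A) (_ : X.left b = 0), {a | a * b = 0} := by
    ext a
    simp [katsuraIdeal]
  rw [h]
  refine ((Submodule.isClosed_topologicalClosure _).preimage X.continuous_left).inter ?_
  exact isClosed_biInter fun b _ =>
    isClosed_eq (continuous_id.mul continuous_const) continuous_const

theorem mul_left_mem_compacts {T : X.carrier →L[ℂ] X.carrier} (hT : T ∈ X.compacts) (a : A) :
    T * X.left a ∈ X.compacts := by
  have h : Set.MapsTo (fun T : X.carrier →L[ℂ] X.carrier => T * X.left a)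
      (Submodule.span ℂ {T : X.carrier →L[ℂ] X.carrier |
        ∃ x y, ∀ z, T z = X.act x (X.inner y z)})
      (Submodule.span ℂ {T : X.carrier →L[ℂ] X.carrier |
        ∃ x y, ∀ z, T z = X.act x (X.inner y z)}) := by
    intro T hT
    induction hT using Submodule.span_induction with
    | mem T hT =>
      obtain ⟨x, y, hxy⟩ := hT
      refine Submodule.subset_span ⟨x, X.left (star a) y, fun z => ?_⟩
      rw [mul_apply_eq_comp, hxy, X.inner_left, star_star]
    | zero => simp
    | add S T _ _ hS hT => simpa only [add_mul, SetLike.mem_coe] using add_mem hS hT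
    | smul c T _ hT => simpa only [smul_mul_assoc, SetLike.mem_coe] using Submodule.smul_mem _ c hT
  exact h.closure (by fun_prop) hT

theorem mul_mem_katsuraIdeal {a : A} (ha : a ∈ X.katsuraIdeal) (b : A) :
    a * b ∈ X.katsuraIdeal := by
  refine ⟨?_, fun c hc => ?_⟩
  · rw [map_mul]
    exact X.mul_left_mem_compacts ha.1 b
  · rw [mul_assoc]
    exact ha.2 _ (by rw [map_mul, hc, mul_zero])

/-! ### Orthonormal bases and elements acting diagonally -/

/-- An orthonormal basis of a Hilbert module: pairwise orthogonal unit vectors with dense linear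
span, such that `⟨u i, u i⟩` acts on `u i` as the identity. (It follows that `⟨u i, u i⟩` is a
projection.) -/
structure IsOrthonormalBasis {ι : Type*} (u : ι → X.carrier) : Prop where
  inner_eq_zero : ∀ i j, i ≠ j → X.inner (u i) (u j) = 0
  norm_eq_one : ∀ i, ‖u i‖ = 1
  act_inner_self : ∀ i, X.act (u i) (X.inner (u i) (u i)) = u i
  span_eq_top : (Submodule.span ℂ (Set.range u)).topologicalClosure = ⊤

namespace IsOrthonormalBasis

variable {X} {ι : Type*} {u : ι → X.carrier}

theorem dense_span (hu : X.IsOrthonormalBasis u) :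
    Dense (Submodule.span ℂ (Set.range u) : Set X.carrier) :=
  (Submodule.dense_iff_topologicalClosure_eq_top).2 hu.span_eq_top

theorem clm_ext (hu : X.IsOrthonormalBasis u) {S T : X.carrier →L[ℂ] X.carrier}
    (h : ∀ i, S (u i) = T (u i)) : S = T :=
  ContinuousLinearMap.ext_on hu.dense_span (by rintro _ ⟨i, rfl⟩; exact h i)

theorem tendsto_inner (hu : X.IsOrthonormalBasis u) (y : X.carrier) :
    Filter.Tendsto (fun i => X.inner y (u i)) Filter.cofinite (nhds 0) := by
  have h0 : ∀ z ∈ Submodule.span ℂ (Set.range u),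
      ∀ᶠ i in Filter.cofinite, X.inner z (u i) = 0 := by
    intro z hz
    induction hz using Submodule.span_induction with
    | mem z hz =>
      obtain ⟨j, rfl⟩ := hz
      filter_upwards [(Set.finite_singleton j).compl_mem_cofinite] with i hi
      exact hu.inner_eq_zero j i (Ne.symm hi)
    | zero => simp
    | add z w _ _ hz hw =>
      filter_upwards [hz, hw] with i hzi hwi
      simp [hzi, hwi]
    | smul c z _ hz =>
      filter_upwards [hz] with i hzi
      simp [hzi]
  rw [Metric.tendsto_nhds]
  intro ε hε
  obtain ⟨z, hz, hyz⟩ := Metric.mem_closure_iff.1 (hu.dense_span y) ε hε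
  filter_upwards [h0 z hz] with i hi
  have h1 : X.inner y (u i) = X.inner (y - z) (u i) := by
    rw [map_sub, LinearMap.sub_apply, hi, sub_zero]
  rw [dist_zero_right, h1]
  refine (X.norm_inner_le _ _).trans_lt ?_
  rwa [hu.norm_eq_one, mul_one, ← dist_eq_norm]

/-- A compact operator tends to zero along an orthonormal basis. -/
theorem tendsto_of_mem_compacts (hu : X.IsOrthonormalBasis u) {T : X.carrier →L[ℂ] X.carrier}
    (hT : T ∈ X.compacts) : Filter.Tendsto (fun i => T (u i)) Filter.cofinite (nhds 0) := by
  have h0 : ∀ S ∈ Submodule.span ℂ {T : X.carrier →L[ℂ] X.carrier |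
      ∃ x y, ∀ z, T z = X.act x (X.inner y z)},
      Filter.Tendsto (fun i => S (u i)) Filter.cofinite (nhds 0) := by
    intro S hS
    induction hS using Submodule.span_induction with
    | mem S hS =>
      obtain ⟨x, y, hxy⟩ := hS
      simp only [hxy]
      refine squeeze_zero_norm (fun i => X.norm_act_le x _) ?_
      simpa using (hu.tendsto_inner y).norm.const_mul ‖x‖
    | zero => simpa using tendsto_const_nhds
    | add S T _ _ hS hT => simpa using hS.add hT
    | smul c S _ hS => simpa using hS.const_smul c
  rw [Metric.tendsto_nhds]
  intro ε hε
  obtain ⟨S, hS, hTS⟩ := Metric.mem_closure_iff.1 hT (ε / 2) (half_pos hε)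
  filter_upwards [Metric.tendsto_nhds.1 (h0 S hS) (ε / 2) (half_pos hε)] with i hi
  have h1 : dist (T (u i)) (S (u i)) < ε / 2 := by
    rw [dist_eq_norm] at hTS ⊢
    refine lt_of_le_of_lt ?_ hTS
    simpa [hu.norm_eq_one] using (T - S).le_opNorm (u i)
  linarith [dist_triangle (T (u i)) (S (u i)) 0]

/-- An element acting as the diagonal projection onto the basis vectors in `R` acts by a compact
operator exactly when `R` is finite: a compact operator tends to zero along the basis, and the
projection onto finitely many basis vectors is the sum of the operators `z ↦ u i · ⟨u i, z⟩`. -/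
theorem left_mem_compacts_iff (hu : X.IsOrthonormalBasis u) {p : A} {R : Set ι}
    (hR : ∀ i ∈ R, X.left p (u i) = u i) (hR' : ∀ i ∉ R, X.left p (u i) = 0) :
    X.left p ∈ X.compacts ↔ R.Finite := by
  classical
  constructor
  · intro h
    have h1 := Metric.tendsto_nhds.1 (hu.tendsto_of_mem_compacts h) 1 one_pos
    refine Set.Finite.subset (Filter.eventually_cofinite.1 h1) fun i hi => ?_
    simp [hR i hi, hu.norm_eq_one]
  · intro h
    let θ : ι → X.carrier →L[ℂ] X.carrier := fun i =>
      LinearMap.mkContinuous ((X.act (u i)).comp (X.inner (u i))) 1 fun z => by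
        refine (X.norm_act_le _ _).trans ?_
        have := X.norm_inner_le (u i) z
        simpa [hu.norm_eq_one] using this
    have hθ : ∀ i z, θ i z = X.act (u i) (X.inner (u i) z) := fun _ _ => rfl
    have hsum : X.left p = ∑ i ∈ h.toFinset, θ i := by
      refine hu.clm_ext fun j => ?_
      rw [sum_apply]
      have h2 : ∀ i, i ≠ j → θ i (u j) = 0 := fun i hij => by
        rw [hθ, hu.inner_eq_zero i j hij, map_zero]
      by_cases hj : j ∈ R
      · rw [hR j hj, Finset.sum_eq_single j (fun i _ => h2 i)
          (fun hj' => absurd (h.mem_toFinset.2 hj) hj'), hθ, hu.act_inner_self]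
      · rw [hR' j hj, Finset.sum_eq_zero fun i hi => h2 i ?_]
        rintro rfl
        exact hj (h.mem_toFinset.1 hi)
    rw [hsum]
    refine Submodule.sum_mem _ fun i _ => Submodule.le_topologicalClosure _ ?_
    exact Submodule.subset_span ⟨u i, u i, hθ i⟩

/-- A minimal projection that acts as the diagonal projection onto the basis vectors in `R` lies in
the Katsura ideal exactly when `R` is finite and nonempty. -/
theorem mem_katsuraIdeal_iff (hu : X.IsOrthonormalBasis u) {p : A} {R : Set ι}
    (hR : ∀ i ∈ R, X.left p (u i) = u i) (hR' : ∀ i ∉ R, X.left p (u i) = 0)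
    (hp0 : p ≠ 0) (hpp : p * p = p) (hmin : ∀ b, ∃ c : ℂ, p * b = c • p) :
    p ∈ X.katsuraIdeal ↔ R.Finite ∧ R.Nonempty := by
  refine and_congr (hu.left_mem_compacts_iff hR hR') ⟨fun h => ?_, ?_⟩
  · by_contra hne
    rw [Set.not_nonempty_iff_eq_empty] at hne
    refine hp0 (hpp.symm.trans (h p (hu.clm_ext fun i => ?_)))
    rw [hR' i (by simp [hne])]
    rfl
  · rintro ⟨i, hi⟩ b hb
    obtain ⟨c, hc⟩ := hmin b
    have h1 : c • u i = 0 := by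
      have h2 : X.left (p * b) (u i) = 0 := by rw [map_mul, hb, mul_zero]; rfl
      rwa [hc, map_smul, _root_.smul_apply, hR i hi] at h2
    have hui : u i ≠ 0 := norm_ne_zero_iff.1 (by rw [hu.norm_eq_one]; exact one_ne_zero)
    rw [hc, (smul_eq_zero.1 h1).resolve_right hui, zero_smul]

end IsOrthonormalBasis

end General

end Correspondence

/-! ### Dense spans in completed tensor products -/

section DenseTensor

/-- If a bilinear map is bounded by the product of the norms and its values span a dense subspace,
then so do its values on two families with dense span. -/
theorem span_bilin_eq_top {Z W G ι κ : Type*} [NormedAddCommGroup Z] [NormedSpace ℂ Z]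
    [NormedAddCommGroup W] [NormedSpace ℂ W] [NormedAddCommGroup G] [NormedSpace ℂ G]
    (T : Z →ₗ[ℂ] W →ₗ[ℂ] G) (hT : ∀ z w, ‖T z w‖ ≤ ‖z‖ * ‖w‖)
    (hdense : ∀ C : Submodule ℂ G, IsClosed (C : Set G) → (∀ z w, T z w ∈ C) → C = ⊤)
    {u : ι → Z} {v : κ → W} (hu : (Submodule.span ℂ (Set.range u)).topologicalClosure = ⊤)
    (hv : (Submodule.span ℂ (Set.range v)).topologicalClosure = ⊤) :
    (Submodule.span ℂ (Set.range fun i : ι × κ => T (u i.1) (v i.2))).topologicalClosure = ⊤ := by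
  set C := (Submodule.span ℂ (Set.range fun i : ι × κ => T (u i.1) (v i.2))).topologicalClosure
  have hC : IsClosed (C : Set G) := Submodule.isClosed_topologicalClosure _
  let L : Z →L[ℂ] W →L[ℂ] G := T.mkContinuous₂ 1 (by simpa using hT)
  have h1 : ∀ i w, T (u i) w ∈ C := by
    intro i w
    have h : (Submodule.span ℂ (Set.range v)).topologicalClosure ≤ C.comap (L (u i)).toLinearMap := by
      refine Submodule.topologicalClosure_minimal _ (Submodule.span_le.2 ?_)
        (hC.preimage (L (u i)).continuous)
      rintro _ ⟨j, rfl⟩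
      exact Submodule.le_topologicalClosure _ (Submodule.subset_span ⟨(i, j), rfl⟩)
    exact h (hv ▸ Submodule.mem_top)
  refine hdense C hC fun z w => ?_
  have h : (Submodule.span ℂ (Set.range u)).topologicalClosure ≤ C.comap (L.flip w).toLinearMap := by
    refine Submodule.topologicalClosure_minimal _ (Submodule.span_le.2 ?_)
      (hC.preimage (L.flip w).continuous)
    rintro _ ⟨i, rfl⟩
    exact h1 i w
  exact h (hu ▸ Submodule.mem_top)

variable {A B : Type*} [NonUnitalCStarAlgebra A] [NonUnitalCStarAlgebra B]

theorem CStarTensor.norm_incl_tmul_le (a : A) (b : B) :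
    ‖CStarTensor.incl A B (a ⊗ₜ b)‖ ≤ ‖a‖ * ‖b‖ :=
  (CStarTensor.norm_incl _).trans_le (isCStarSeminorm_tensorSeminorm.tmul_le a b)

theorem CStarTensor.eq_top_of_incl_tmul_mem (C : Submodule ℂ (CStarTensor A B))
    (hC : IsClosed (C : Set (CStarTensor A B)))
    (h : ∀ a b, CStarTensor.incl A B (a ⊗ₜ b) ∈ C) : C = ⊤ := by
  refine Submodule.eq_top_iff'.2 fun x => CStarTensor.induction hC (fun t => ?_) x
  change CStarTensor.incl A B t ∈ C
  induction t using TensorProduct.induction_on with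
  | zero => simp
  | tmul a b => exact h a b
  | add s t hs ht => simpa using add_mem hs ht

theorem CStarTensor.span_incl_tmul_eq_top {ι κ : Type*} {u : ι → A} {v : κ → B}
    (hu : (Submodule.span ℂ (Set.range u)).topologicalClosure = ⊤)
    (hv : (Submodule.span ℂ (Set.range v)).topologicalClosure = ⊤) :
    (Submodule.span ℂ (Set.range fun i : ι × κ =>
      CStarTensor.incl A B (u i.1 ⊗ₜ v i.2))).topologicalClosure = ⊤ :=
  span_bilin_eq_top ((TensorProduct.mk ℂ A B).compr₂ (CStarTensor.ofAlg A B))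
    CStarTensor.norm_incl_tmul_le CStarTensor.eq_top_of_incl_tmul_mem hu hv

end DenseTensor

/-! ### Orthonormal bases of external tensor products -/

namespace Correspondence

variable {A B : Type*} [NonUnitalCStarAlgebra A] [NonUnitalCStarAlgebra B]
  (X : Correspondence A) (Y : Correspondence B)

/-- The elementary tensor `x ⊗ y` in the external tensor product, as a bilinear map. -/
noncomputable def elemTensor : X.carrier →ₗ[ℂ] Y.carrier →ₗ[ℂ] (externalTensor X Y).carrier :=
  (TensorProduct.mk ℂ X.carrier Y.carrier).compr₂ (tensorPre X Y).toCompleted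

theorem inner_elemTensor (x x' : X.carrier) (y y' : Y.carrier) :
    (externalTensor X Y).inner (elemTensor X Y x y) (elemTensor X Y x' y') =
      CStarTensor.incl A B (X.inner x x' ⊗ₜ Y.inner y y') :=
  (tensorPre X Y).innerL_mk _ _

theorem act_elemTensor (x : X.carrier) (y : Y.carrier) (a : A) (b : B) :
    (externalTensor X Y).act (elemTensor X Y x y) (CStarTensor.incl A B (a ⊗ₜ b)) =
      elemTensor X Y (X.act x a) (Y.act y b) :=
  (tensorPre X Y).actL_mk _ _

theorem left_elemTensor (x : X.carrier) (y : Y.carrier) (a : A) (b : B) :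
    (externalTensor X Y).left (CStarTensor.incl A B (a ⊗ₜ b)) (elemTensor X Y x y) =
      elemTensor X Y (X.left a x) (Y.left b y) :=
  (tensorPre X Y).leftL_mk _ _ _ _

theorem norm_elemTensor_sq (x : X.carrier) (y : Y.carrier) :
    ‖elemTensor X Y x y‖ ^ 2 = ‖CStarTensor.incl A B (X.inner x x ⊗ₜ Y.inner y y)‖ := by
  rw [(externalTensor X Y).norm_sq, inner_elemTensor]

theorem norm_elemTensor_le (x : X.carrier) (y : Y.carrier) :
    ‖elemTensor X Y x y‖ ≤ ‖x‖ * ‖y‖ := by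
  refine le_of_sq_le_sq ?_ (by positivity)
  rw [norm_elemTensor_sq, mul_pow, X.norm_sq, Y.norm_sq]
  exact CStarTensor.norm_incl_tmul_le _ _

theorem IsOrthonormalBasis.tensor {X : Correspondence A} {Y : Correspondence B} {ι κ : Type*}
    {u : ι → X.carrier} {v : κ → Y.carrier} (hu : X.IsOrthonormalBasis u)
    (hv : Y.IsOrthonormalBasis v)
    (hnorm : ∀ i j,
      ‖CStarTensor.incl A B (X.inner (u i) (u i) ⊗ₜ Y.inner (v j) (v j))‖ = 1) :
    (externalTensor X Y).IsOrthonormalBasis fun i : ι × κ => elemTensor X Y (u i.1) (v i.2) where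
  inner_eq_zero := by
    rintro ⟨i, j⟩ ⟨i', j'⟩ hij
    rw [inner_elemTensor]
    by_cases hi : i = i'
    · have hj : j ≠ j' := fun hj => hij (by rw [hi, hj])
      rw [hv.inner_eq_zero _ _ hj, TensorProduct.tmul_zero, map_zero]
    · rw [hu.inner_eq_zero _ _ hi, TensorProduct.zero_tmul, map_zero]
  norm_eq_one i := by
    rw [← pow_eq_one_iff_of_nonneg (norm_nonneg _) two_ne_zero, norm_elemTensor_sq, hnorm]
  act_inner_self i := by
    rw [inner_elemTensor, act_elemTensor, hu.act_inner_self, hv.act_inner_self]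
  span_eq_top := by
    refine span_bilin_eq_top (elemTensor X Y) (norm_elemTensor_le X Y) (fun C hC h => ?_)
      hu.span_eq_top hv.span_eq_top
    refine Submodule.eq_top_iff'.2 fun z =>
      (tensorPre X Y).denseRange_toCompleted.induction_on (p := (· ∈ C)) z hC fun t => ?_
    let L : X.carrier ⊗[ℂ] Y.carrier →ₗ[ℂ] (externalTensor X Y).carrier :=
      (tensorPre X Y).toCompleted
    change L t ∈ C
    induction t using TensorProduct.induction_on with
    | zero => rw [map_zero]; exact zero_mem _
    | tmul x y => exact h x y
    | add s t hs ht => rw [map_add]; exact add_mem hs ht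

end Correspondence

/-! ### Point evaluations -/

section Evaluation

variable {V : Type*} [TopologicalSpace V]

theorem norm_apply_le (a : C₀(V, ℂ)) (v : V) : ‖a v‖ ≤ ‖a‖ := by
  rw [← ZeroAtInftyContinuousMap.norm_toBCF_eq_norm]
  exact a.toBCF.norm_coe_le_norm v

theorem norm_le_of_apply_le {a : C₀(V, ℂ)} {C : ℝ} (hC : 0 ≤ C) (h : ∀ v, ‖a v‖ ≤ C) :
    ‖a‖ ≤ C := by
  rw [← ZeroAtInftyContinuousMap.norm_toBCF_eq_norm]
  exact (BoundedContinuousFunction.norm_le hC).2 h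

/-- The evaluation at a point, as a character of `c₀(V)`. -/
noncomputable def evalHom (v : V) : C₀(V, ℂ) →⋆ₙₐ[ℂ] ℂ where
  toFun a := a v
  map_smul' _ _ := rfl
  map_zero' := rfl
  map_add' _ _ := rfl
  map_mul' _ _ := rfl
  map_star' _ := rfl

end Evaluation

/-- The product of two characters is a character of the algebraic tensor product, hence bounded by
its C⋆-norm. -/
theorem norm_mul_le_norm_incl {A B : Type*} [NonUnitalCStarAlgebra A] [NonUnitalCStarAlgebra B]
    (f : A →⋆ₙₐ[ℂ] ℂ) (g : B →⋆ₙₐ[ℂ] ℂ) (a : A) (b : B) :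
    ‖f a * g b‖ ≤ ‖CStarTensor.incl A B (a ⊗ₜ b)‖ := by
  let L : A ⊗[ℂ] B →ₗ[ℂ] ℂ := LinearMap.mul' ℂ ℂ ∘ₗ TensorProduct.map (f : A →ₗ[ℂ] ℂ) (g : B →ₗ[ℂ] ℂ)
  have hL : ∀ a b, L (a ⊗ₜ b) = f a * g b := fun _ _ => rfl
  have hmul : ∀ s t, L (s * t) = L s * L t := by
    intro s t
    induction s using TensorProduct.induction_on with
    | zero => simp
    | add s s' hs hs' => simp only [add_mul, map_add, hs, hs']
    | tmul a b =>
      induction t using TensorProduct.induction_on with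
      | zero => simp
      | add t t' ht ht' => simp only [mul_add, map_add, ht, ht']
      | tmul a' b' =>
        rw [Algebra.TensorProduct.tmul_mul_tmul, hL, hL, hL, map_mul, map_mul, mul_mul_mul_comm]
  have hstar : ∀ t, L (star t) = star (L t) := by
    intro t
    induction t using TensorProduct.induction_on with
    | zero => simp
    | add t t' ht ht' => simp only [star_add, map_add, ht, ht']
    | tmul a b => rw [TensorProduct.star_tmul, hL, hL, map_star, map_star, star_mul']
  have h : IsCStarSeminorm ((normSeminorm ℂ ℂ).comp L) :=
    { mul_le := fun s t => by simp [hmul]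
      star_mul_self := fun t => by simp [hmul, hstar, sq]
      tmul_le := fun a b => by
        simp only [Seminorm.comp_apply, coe_normSeminorm, hL, norm_mul]
        exact mul_le_mul (NonUnitalStarAlgHom.norm_apply_le f a)
          (NonUnitalStarAlgHom.norm_apply_le g b) (norm_nonneg _) (norm_nonneg _) }
  exact (h.le_tensorSeminorm (a ⊗ₜ b)).trans_eq (CStarTensor.norm_incl _).symm

/-! ### Point masses -/

section PointMass

variable {V W : Type*} [TopologicalSpace V] [DiscreteTopology V] [TopologicalSpace W]
  [DiscreteTopology W]

open Classical in
/-- The indicator function of the point `v`, as an element of `c₀(V)`. -/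
noncomputable def pointMass (v : V) : C₀(V, ℂ) where
  toFun := Pi.single v 1
  continuous_toFun := continuous_of_discreteTopology
  zero_at_infty' := by
    rw [Filter.cocompact_eq_cofinite]
    refine tendsto_nhds_of_eventually_eq ?_
    filter_upwards [(Set.finite_singleton v).compl_mem_cofinite] with w hw
    exact Pi.single_eq_of_ne hw _

theorem pointMass_self (v : V) : pointMass v v = 1 := by
  classical exact Pi.single_eq_same (M := fun _ => ℂ) v 1

theorem pointMass_of_ne {v w : V} (h : w ≠ v) : pointMass v w = 0 := by
  classical exact Pi.single_eq_of_ne (M := fun _ => ℂ) h 1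

theorem pointMass_mul (v : V) (a : C₀(V, ℂ)) : pointMass v * a = a v • pointMass v := by
  ext w
  by_cases h : w = v
  · subst h
    simp [pointMass_self]
  · simp [pointMass_of_ne h]

theorem norm_pointMass_le (v : V) : ‖pointMass v‖ ≤ 1 := by
  refine norm_le_of_apply_le zero_le_one fun w => ?_
  by_cases h : w = v
  · subst h
    simp [pointMass_self]
  · simp [pointMass_of_ne h]

theorem span_pointMass_eq_top :
    (Submodule.span ℂ (Set.range (pointMass : V → C₀(V, ℂ)))).topologicalClosure = ⊤ := by
  refine Submodule.eq_top_iff'.2 fun a => Metric.mem_closure_iff.2 fun ε hε => ?_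
  have ha := a.zero_at_infty'
  rw [Filter.cocompact_eq_cofinite] at ha
  have hfin := Filter.eventually_cofinite.1 (Metric.tendsto_nhds.1 ha (ε / 2) (half_pos hε))
  refine ⟨∑ v ∈ hfin.toFinset, a v • pointMass v, Submodule.sum_mem _ fun v _ =>
    Submodule.smul_mem _ _ (Submodule.subset_span ⟨v, rfl⟩), ?_⟩
  rw [dist_eq_norm]
  refine (norm_le_of_apply_le (half_pos hε).le fun w => ?_).trans_lt (half_lt_self hε)
  have hsum : (∑ v ∈ hfin.toFinset, a v • pointMass v) w =
      ∑ v ∈ hfin.toFinset, a v * pointMass v w := by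
    let ev : C₀(V, ℂ) →+ ℂ := ⟨⟨fun f => f w, rfl⟩, fun _ _ => rfl⟩
    exact map_sum ev _ _
  rw [ZeroAtInftyContinuousMap.sub_apply, hsum]
  by_cases hw : w ∈ hfin.toFinset
  · rw [Finset.sum_eq_single w (fun v _ hv => by rw [pointMass_of_ne hv.symm, mul_zero])
      (fun h => absurd hw h), pointMass_self]
    simpa using (half_pos hε).le
  · rw [Finset.sum_eq_zero fun v hv => by
      rw [pointMass_of_ne (by rintro rfl; exact hw hv), mul_zero]]
    rw [hfin.mem_toFinset] at hw
    simpa using (not_not.1 hw).le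

/-- The elementary tensor of two point masses, in the C⋆-algebra `c₀(V) ⊗ c₀(W)`. -/
noncomputable def tensorPointMass (i : V × W) : CStarTensor C₀(V, ℂ) C₀(W, ℂ) :=
  CStarTensor.incl _ _ (pointMass i.1 ⊗ₜ pointMass i.2)

theorem norm_tensorPointMass (i : V × W) : ‖tensorPointMass i‖ = 1 := by
  refine le_antisymm ?_ ?_
  · exact (CStarTensor.norm_incl_tmul_le _ _).trans
      (mul_le_one₀ (norm_pointMass_le _) (norm_nonneg _) (norm_pointMass_le _))
  · have h := norm_mul_le_norm_incl (evalHom i.1) (evalHom i.2) (pointMass i.1) (pointMass i.2)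
    change ‖pointMass i.1 i.1 * pointMass i.2 i.2‖ ≤ _ at h
    rwa [pointMass_self, pointMass_self, mul_one, norm_one] at h

theorem tensorPointMass_ne_zero (i : V × W) : tensorPointMass i ≠ 0 :=
  norm_ne_zero_iff.1 (by rw [norm_tensorPointMass]; exact one_ne_zero)

theorem incl_tmul_mul_tensorPointMass (a : C₀(V, ℂ)) (b : C₀(W, ℂ)) (i : V × W) :
    CStarTensor.incl _ _ (a ⊗ₜ b) * tensorPointMass i = (a i.1 * b i.2) • tensorPointMass i := by
  rw [tensorPointMass, ← map_mul, Algebra.TensorProduct.tmul_mul_tmul, mul_comm a, mul_comm b,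
    pointMass_mul, pointMass_mul, TensorProduct.smul_tmul_smul, map_smul]

theorem tensorPointMass_mul_self (i : V × W) :
    tensorPointMass i * tensorPointMass i = tensorPointMass i := by
  refine (incl_tmul_mul_tensorPointMass (pointMass i.1) (pointMass i.2) i).trans ?_
  rw [pointMass_self, pointMass_self, mul_one, one_smul]

theorem mul_tensorPointMass_comm (t : CStarTensor C₀(V, ℂ) C₀(W, ℂ)) (i : V × W) :
    tensorPointMass i * t = t * tensorPointMass i := by
  refine CStarTensor.induction (P := fun t => tensorPointMass i * t = t * tensorPointMass i)
    (isClosed_eq (by fun_prop) (by fun_prop)) (fun t => ?_) t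
  change tensorPointMass i * CStarTensor.incl _ _ t = CStarTensor.incl _ _ t * tensorPointMass i
  induction t using TensorProduct.induction_on with
  | zero => simp
  | tmul a b =>
    rw [tensorPointMass, ← map_mul, ← map_mul, Algebra.TensorProduct.tmul_mul_tmul,
      Algebra.TensorProduct.tmul_mul_tmul, mul_comm a, mul_comm b]
  | add s t hs ht => rw [map_add, mul_add, add_mul, hs, ht]

theorem exists_mul_tensorPointMass (t : CStarTensor C₀(V, ℂ) C₀(W, ℂ)) (i : V × W) :
    ∃ c : ℂ, t * tensorPointMass i = c • tensorPointMass i := by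
  suffices h : t * tensorPointMass i ∈ Submodule.span ℂ {tensorPointMass i} by
    obtain ⟨c, hc⟩ := Submodule.mem_span_singleton.1 h
    exact ⟨c, hc.symm⟩
  refine CStarTensor.induction
    (P := fun t => t * tensorPointMass i ∈ Submodule.span ℂ {tensorPointMass i})
    ((Submodule.closed_of_finiteDimensional _).preimage
      (continuous_id.mul continuous_const)) (fun t => ?_) t
  change CStarTensor.incl _ _ t * _ ∈ _
  induction t using TensorProduct.induction_on with
  | zero => simp
  | tmul a b =>
    exact Submodule.mem_span_singleton.2 ⟨_, (incl_tmul_mul_tensorPointMass a b i).symm⟩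
  | add s t hs ht => simpa [add_mul] using add_mem hs ht

/-- An element `t` of `c₀(V) ⊗ c₀(W)` lies in every closed subspace containing its products with the
point masses: such a subspace contains `t * x` for all `x`, and `t` is the limit of `t * x` along an
approximate unit. -/
theorem mem_of_mul_tensorPointMass_mem {C : Submodule ℂ (CStarTensor C₀(V, ℂ) C₀(W, ℂ))}
    (hC : IsClosed (C : Set (CStarTensor C₀(V, ℂ) C₀(W, ℂ))))
    {t : CStarTensor C₀(V, ℂ) C₀(W, ℂ)} (h : ∀ i, t * tensorPointMass i ∈ C) : t ∈ C := by
  have hmul : ∀ x, t * x ∈ C := by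
    have h1 : (Submodule.span ℂ (Set.range (tensorPointMass (V := V) (W := W)))).topologicalClosure
        ≤ C.comap (LinearMap.mulLeft ℂ t) := by
      refine Submodule.topologicalClosure_minimal _ (Submodule.span_le.2 ?_)
        (hC.preimage (continuous_const.mul continuous_id))
      rintro _ ⟨i, rfl⟩
      exact h i
    have h2 : (Submodule.span ℂ (Set.range (tensorPointMass (V := V) (W := W)))).topologicalClosure
        = ⊤ := CStarTensor.span_incl_tmul_eq_top span_pointMass_eq_top span_pointMass_eq_top
    exact fun x => h1 (h2 ▸ Submodule.mem_top)
  let _ := CStarAlgebra.spectralOrder (CStarTensor C₀(V, ℂ) C₀(W, ℂ))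
  let _ := CStarAlgebra.spectralOrderedRing (CStarTensor C₀(V, ℂ) C₀(W, ℂ))
  have hl := CStarAlgebra.increasingApproximateUnit (CStarTensor C₀(V, ℂ) C₀(W, ℂ))
  have := hl.neBot
  exact hC.mem_of_tendsto (hl.tendsto_mul_left t) (Filter.Eventually.of_forall hmul)

end PointMass

/-! ### The Katsura ideal of a graph correspondence -/

namespace DirectedGraph

theorem mulFun_single {E : Type*} (w : E → ℂ) (e : E) :
    mulFun w (Finsupp.single e 1) = Finsupp.single e (w e) := by
  ext f
  by_cases h : f = e
  · subst h
    simp [mulFun_apply]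
  · simp [mulFun_apply, Finsupp.single_eq_of_ne h]

variable {V E : Type*} [TopologicalSpace V] [DiscreteTopology V] (G : DirectedGraph V E)

/-- The canonical map of the finitely supported functions on the edges into the graph
correspondence. -/
noncomputable def ofFinsupp : (E →₀ ℂ) →ₗ[ℂ] G.correspondence.carrier := G.preHilbert.toCompleted

/-- The indicator function of the edge `e`, as a vector of the graph correspondence. -/
noncomputable def edgeVector (e : E) : G.correspondence.carrier :=
  G.ofFinsupp (Finsupp.single e 1)

theorem ofFinsupp_single (e : E) (c : ℂ) :
    G.ofFinsupp (Finsupp.single e c) = c • G.edgeVector e := by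
  rw [edgeVector, ← map_smul, Finsupp.smul_single_one]

theorem inner_edgeVector_self (e : E) :
    G.correspondence.inner (G.edgeVector e) (G.edgeVector e) = pointMass (G.s e) := by
  classical
  refine (G.preHilbert.innerL_mk _ _).trans ?_
  ext v
  refine (G.innerFun_apply_of_subset _ _ {e} Finsupp.support_single_subset v).trans ?_
  by_cases h : G.s e = v
  · subst h
    simp [Finset.filter_singleton, pointMass_self]
  · simp [Finset.filter_singleton, h, pointMass_of_ne (Ne.symm h)]

theorem inner_edgeVector_of_ne {e f : E} (h : e ≠ f) :
    G.correspondence.inner (G.edgeVector e) (G.edgeVector f) = 0 := by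
  classical
  refine (G.preHilbert.innerL_mk _ _).trans ?_
  ext v
  refine (G.innerFun_apply_of_subset _ _ {e} Finsupp.support_single_subset v).trans ?_
  refine Finset.sum_eq_zero fun e' he' => ?_
  rw [Finset.mem_filter, Finset.mem_singleton] at he'
  rw [he'.1, Finsupp.single_eq_of_ne h, mul_zero]

theorem act_edgeVector (e : E) (a : C₀(V, ℂ)) :
    G.correspondence.act (G.edgeVector e) a = a (G.s e) • G.edgeVector e := by
  refine (G.preHilbert.actL_mk (Finsupp.single e 1) a).trans ?_
  rw [← ofFinsupp_single]
  exact congrArg G.ofFinsupp (mulFun_single _ e)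

theorem left_edgeVector (e : E) (a : C₀(V, ℂ)) :
    G.correspondence.left a (G.edgeVector e) = a (G.r e) • G.edgeVector e := by
  refine (G.preHilbert.leftL_mk _ _ a (Finsupp.single e 1)).trans ?_
  rw [← ofFinsupp_single]
  exact congrArg G.ofFinsupp (mulFun_single _ e)

theorem isOrthonormalBasis_edgeVector : G.correspondence.IsOrthonormalBasis G.edgeVector where
  inner_eq_zero _ _ := G.inner_edgeVector_of_ne
  norm_eq_one e := by
    rw [← pow_eq_one_iff_of_nonneg (norm_nonneg _) two_ne_zero, G.correspondence.norm_sq,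
      inner_edgeVector_self]
    refine le_antisymm (norm_pointMass_le _) ?_
    simpa [pointMass_self] using norm_apply_le (pointMass (G.s e)) (G.s e)
  act_inner_self e := by
    rw [inner_edgeVector_self, act_edgeVector, pointMass_self, one_smul]
  span_eq_top := by
    have hd : DenseRange G.ofFinsupp := G.preHilbert.denseRange_toCompleted
    refine Submodule.eq_top_iff'.2 fun z => hd.induction_on z
      (Submodule.isClosed_topologicalClosure _) fun x => ?_
    induction x using Finsupp.induction_linear with
    | zero => rw [map_zero]; exact zero_mem _
    | add x y hx hy => rw [map_add]; exact add_mem hx hy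
    | single e c =>
      rw [ofFinsupp_single]
      exact Submodule.smul_mem _ _ (Submodule.le_topologicalClosure _
        (Submodule.subset_span ⟨e, rfl⟩))

/-- The point mass at `v` lies in the Katsura ideal exactly when `v` is a regular vertex: it
receives at least one edge, and only finitely many. -/
theorem pointMass_mem_katsuraIdeal_iff (v : V) :
    pointMass v ∈ G.correspondence.katsuraIdeal ↔
      (G.r ⁻¹' {v}).Finite ∧ (G.r ⁻¹' {v}).Nonempty := by
  refine G.isOrthonormalBasis_edgeVector.mem_katsuraIdeal_iff (fun e he => ?_) (fun e he => ?_)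
    (fun h => ?_) ?_ fun b => ⟨b v, pointMass_mul v b⟩
  · rw [left_edgeVector, he, pointMass_self, one_smul]
  · rw [left_edgeVector, pointMass_of_ne he, zero_smul]
  · have h1 := pointMass_self v
    rw [h] at h1
    exact zero_ne_one h1
  · rw [pointMass_mul, pointMass_self, one_smul]

variable {W F : Type*} [TopologicalSpace W] [DiscreteTopology W] (H : DirectedGraph W F)

theorem isOrthonormalBasis_elemTensor_edgeVector :
    (externalTensor G.correspondence H.correspondence).IsOrthonormalBasis fun i : E × F =>
      elemTensor G.correspondence H.correspondence (G.edgeVector i.1) (H.edgeVector i.2) :=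
  G.isOrthonormalBasis_edgeVector.tensor H.isOrthonormalBasis_edgeVector fun e f => by
    rw [inner_edgeVector_self, inner_edgeVector_self]
    exact norm_tensorPointMass (G.s e, H.s f)

/-- The fibre of the product graph over `(v, w)` is the product of the fibres, and a product of two
sets is finite and nonempty exactly when both factors are. -/
theorem tensorPointMass_mem_katsuraIdeal_iff (i : V × W) :
    tensorPointMass i ∈ (externalTensor G.correspondence H.correspondence).katsuraIdeal ↔
      pointMass i.1 ∈ G.correspondence.katsuraIdeal ∧
        pointMass i.2 ∈ H.correspondence.katsuraIdeal := by
  rw [pointMass_mem_katsuraIdeal_iff, pointMass_mem_katsuraIdeal_iff,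
    (isOrthonormalBasis_elemTensor_edgeVector G H).mem_katsuraIdeal_iff
      (R := (G.r ⁻¹' {i.1}) ×ˢ (H.r ⁻¹' {i.2})) ?_ ?_ (tensorPointMass_ne_zero i)
      (tensorPointMass_mul_self i) fun b => by
        rw [mul_tensorPointMass_comm]
        exact exists_mul_tensorPointMass b i]
  · constructor
    · rintro ⟨hfin, hne⟩
      have hne' := Set.prod_nonempty_iff.1 hne
      exact ⟨⟨hfin.of_prod_left hne'.2, hne'.1⟩, ⟨hfin.of_prod_right hne'.1, hne'.2⟩⟩
    · rintro ⟨⟨h1, h2⟩, h3, h4⟩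
      exact ⟨h1.prod h3, h2.prod h4⟩
  · rintro ⟨e, f⟩ ⟨he, hf⟩
    rw [tensorPointMass, left_elemTensor, left_edgeVector, left_edgeVector, he, hf,
      pointMass_self, pointMass_self, one_smul, one_smul]
  · rintro ⟨e, f⟩ hef
    rw [tensorPointMass, left_elemTensor, left_edgeVector, left_edgeVector]
    by_cases he : G.r e = i.1
    · have hf : H.r f ≠ i.2 := fun hf => hef ⟨he, hf⟩
      rw [pointMass_of_ne hf, zero_smul, map_zero]
    · rw [pointMass_of_ne he, zero_smul, map_zero, LinearMap.zero_apply]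

theorem idealCompatible_correspondence :
    IdealCompatible G.correspondence H.correspondence := by
  refine le_antisymm (fun t ht => ?_) ?_
  -- Both inclusions are tested on point masses: `t * p` is a multiple `c • p` of the point mass `p`,
  -- and if `c ≠ 0`, membership of `t` in the ideal passes to `p`.
  · refine mem_of_mul_tensorPointMass_mem (Submodule.isClosed_topologicalClosure _) fun i => ?_
    have hmem := (externalTensor _ _).mul_mem_katsuraIdeal ht (tensorPointMass i)
    obtain ⟨c, hc⟩ := exists_mul_tensorPointMass t i
    rw [hc] at hmem ⊢
    rcases eq_or_ne c 0 with rfl | hc0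
    · rw [zero_smul]
      exact zero_mem _
    · rw [Submodule.smul_mem_iff _ hc0,
        tensorPointMass_mem_katsuraIdeal_iff] at hmem
      exact Submodule.smul_mem _ c (Submodule.le_topologicalClosure _
        (Submodule.subset_span ⟨_, hmem.1, _, hmem.2, rfl⟩))
  · refine Submodule.topologicalClosure_minimal _ (Submodule.span_le.2 ?_)
      (isClosed_katsuraIdeal _)
    rintro _ ⟨a, ha, b, hb, rfl⟩
    refine mem_of_mul_tensorPointMass_mem (isClosed_katsuraIdeal _) fun i => ?_
    rw [incl_tmul_mul_tensorPointMass]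
    rcases eq_or_ne (a i.1 * b i.2) 0 with h0 | h0
    · rw [h0, zero_smul]
      exact zero_mem _
    · have ha' := G.correspondence.mul_mem_katsuraIdeal ha (pointMass i.1)
      have hb' := H.correspondence.mul_mem_katsuraIdeal hb (pointMass i.2)
      rw [mul_comm, pointMass_mul, Submodule.smul_mem_iff _ (left_ne_zero_of_mul h0)] at ha'
      rw [mul_comm, pointMass_mul, Submodule.smul_mem_iff _ (right_ne_zero_of_mul h0)] at hb'
      exact Submodule.smul_mem _ _
        ((tensorPointMass_mem_katsuraIdeal_iff G H i).2 ⟨ha', hb'⟩)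

end DirectedGraph

end CStarCorr

theorem mainTheorem3 {V W E F : Type*} [TopologicalSpace V] [DiscreteTopology V]
    [TopologicalSpace W] [DiscreteTopology W]
    (G : CStarCorr.DirectedGraph V E) (H : CStarCorr.DirectedGraph W F) :
    CStarCorr.Correspondence.IdealCompatible G.correspondence H.correspondence :=
  G.idealCompatible_correspondence H
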